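/- Let $\sigma$ be the Lysenok substitution over the alphabet $\{a,b,c,d\}$, given by $\sigma(a)=aca$, $\sigma(b)=d$, $\sigma(c)=b$, $\sigma(d)=c$, and let $\xi=\xi_1\xi_2\xi_3\dots=acabacad\dots$ be the unique infinite word fixed by $\sigma$. Let $\Omega$ be the space of all bi-infinite sequences $\omega=\dots\omega_{-1}\omega_0.\omega_1\omega_2\dots$ over $\{a,b,c,d\}$ such that every finite subword of $\omega$ occurs in $\xi$, with the topology induced from the product topology, and let $T:\Omega\to\Omega$ be the shift, $(T\omega)_n=\omega_{n+1}$ for all $n\in\mathbb{Z}$. The topological full group $[[T]]$ is the group of all homeomorphisms $f:\Omega\to\Omega$ for which there is a continuous function $\nu:\Omega\to\mathbb{Z}$ with $f(\omega)=T^{\nu(\omega)}(\omega)$ for all $\omega\in\Omega$. For a finite word $w$ of length $N$ let $[.w]$ be the clopen set of all $\omega\in\Omega$ with $\omega_1\omega_2\dots\omega_N=w$. For a clopen set $U\subset\Omega$ disjoint from $T(U)$ let $\delta_U:\Omega\to\Omega$ be the homeomorphism given by $\delta_U(\omega)=T(\omega)$ if $\omega\in U$, $\delta_U(\omega)=T^{-1}(\omega)$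 if $\omega\in T(U)$, and $\delta_U(\omega)=\omega$ otherwise; it is defined for $U=[.w]$ whenever $w$ is non-empty, since $\xi$ has no double letters. Then $[[T]]$ is generated, as a group, by the four elements $T$, $\delta_{[.b]}$, $\delta_{[.d]}$ and $\delta_{[.acacac]}$. In particular, $[[T]]$ is finitely generated. -/

import Mathlib

/-! ## Topological full groups of homeomorphisms -/

/-- The topological full group `[[T]]` of a homeomorphism `T : X → X`: all homeomorphisms `f` of the
form `f x = T ^ (ν x) x` for some continuous `ν : X → ℤ` (with `ℤ` discrete). -/
def topologicalFullGroup {X : Type*} [TopologicalSpace X] (T : X ≃ₜ X) : Subgroup (X ≃ₜ X) where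
  carrier := {f | ∃ ν : X → ℤ, Continuous ν ∧ ∀ x, f x = (T ^ ν x) x}
  one_mem' := ⟨fun _ => 0, continuous_const, fun x => by simp⟩
  mul_mem' := by
    rintro f g ⟨ν, hν, hf⟩ ⟨μ, hμ, hg⟩
    refine ⟨fun x => ν (g x) + μ x, (hν.comp g.continuous).add hμ, fun x => ?_⟩
    rw [zpow_add]
    change f (g x) = (T ^ ν (g x)) ((T ^ μ x) x)
    rw [hf (g x), ← hg x]
  inv_mem' := by
    rintro f ⟨ν, hν, hf⟩
    refine ⟨fun x => -ν (f.symm x), (hν.comp f.symm.continuous).neg, fun x => ?_⟩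
    change f.symm x = (T ^ (-ν (f.symm x))) x
    have h := hf (f.symm x)
    rw [f.apply_symm_apply] at h
    rw [zpow_neg]
    change f.symm x = (T ^ ν (f.symm x)).symm x
    rw [Homeomorph.eq_symm_apply]
    exact h.symm

open Classical in
/-- The map `δ_U`: it equals `T` on `U`, `T⁻¹` on `T(U)`, and the identity elsewhere. -/
noncomputable def deltaFun {X : Type*} [TopologicalSpace X] (T : X ≃ₜ X) (U : Set X) (x : X) : X :=
  if x ∈ U then T x else if x ∈ T '' U then T.symm x else x

theorem deltaFun_involutive {X : Type*} [TopologicalSpace X] (T : X ≃ₜ X) (U : Set X)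
    (hd : Disjoint U (T '' U)) : Function.Involutive (deltaFun T U) := by
  intro x
  by_cases hx : x ∈ U
  · have h1 : T x ∈ T '' U := ⟨x, hx, rfl⟩
    have h2 : T x ∉ U := fun h => Set.disjoint_left.1 hd h h1
    have h3 : deltaFun T U x = T x := if_pos hx
    rw [h3, deltaFun, if_neg h2, if_pos h1, T.symm_apply_apply]
  · by_cases hx' : x ∈ T '' U
    · obtain ⟨y, hy, rfl⟩ := hx'
      simp [deltaFun, hx, hy]
    · have h3 : deltaFun T U x = x := by rw [deltaFun, if_neg hx, if_neg hx']
      rw [h3, h3]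

theorem deltaFun_continuous {X : Type*} [TopologicalSpace X] (T : X ≃ₜ X) (U : Set X)
    (hU : IsClopen U) : Continuous (deltaFun T U) := by
  classical
  have hU' : IsClopen (T '' U) := ⟨T.isClosedMap _ hU.1, T.isOpenMap _ hU.2⟩
  refine continuous_if (p := fun x => x ∈ U) ?_ T.continuous.continuousOn
    (Continuous.continuousOn (continuous_if (p := fun x => x ∈ T '' U) ?_
      T.symm.continuous.continuousOn continuous_id.continuousOn))
  · intro x hx
    have : frontier {x | x ∈ U} = ∅ := hU.frontier_eq
    rw [this] at hx
    exact hx.elim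
  · intro x hx
    have : frontier {x | x ∈ T '' U} = ∅ := hU'.frontier_eq
    rw [this] at hx
    exact hx.elim

/-- The involutive homeomorphism `δ_U`, defined for a clopen set `U` disjoint from `T(U)`. -/
noncomputable def delta {X : Type*} [TopologicalSpace X] (T : X ≃ₜ X) (U : Set X)
    (hU : IsClopen U) (hd : Disjoint U (T '' U)) : X ≃ₜ X where
  toFun := deltaFun T U
  invFun := deltaFun T U
  left_inv := deltaFun_involutive T U hd
  right_inv := deltaFun_involutive T U hd
  continuous_toFun := deltaFun_continuous T U hU
  continuous_invFun := deltaFun_continuous T U hU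

namespace Lysenok

/-! ## The Lysenok substitution and its fixed point -/

/-- The alphabet `{a, b, c, d}`. -/
inductive Letter : Type
  | a | b | c | d
  deriving DecidableEq

open Letter

instance : TopologicalSpace Letter := ⊥

instance : DiscreteTopology Letter := ⟨rfl⟩

/-- The substitution `a ↦ aca`, `b ↦ d`, `c ↦ b`, `d ↦ c` on letters. -/
def subst : Letter → List Letter
  | a => [a, c, a]
  | b => [d]
  | c => [b]
  | d => [c]

/-- The action of the substitution on finite words. -/
def substWord (w : List Letter) : List Letter := w.flatMap subst

/-- The action of the substitution on infinite words: as the substitution does not shorten words,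
the first `n + 1` letters of `x` determine the `n`-th letter (counted from `0`) of the image. -/
def substSeq (x : ℕ → Letter) (n : ℕ) : Letter :=
  (substWord (List.ofFn fun i : Fin (n + 1) => x i)).getD n a

/-- The infinite word `ξ = acabacad…`, indexed from `0`: each of the words obtained from `a` by
iterating the substitution is a beginning of `ξ`, and the `n`-th iterate is longer than `n`.
It is the only infinite word fixed by the substitution, see `substSeq_eq_self_iff`. -/
def xi (n : ℕ) : Letter := (substWord^[n] [a]).getD n a

theorem length_le_substWord (w : List Letter) : w.length ≤ (substWord w).length := by
  induction w with
  | nil => simp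
  | cons x w ih =>
    have h : 1 ≤ (subst x).length := by cases x <;> simp [subst]
    simp only [substWord, List.flatMap_cons, List.length_append, List.length_cons] at ih ⊢
    omega

theorem substWord_prefix {u w : List Letter} (h : u <+: w) : substWord u <+: substWord w := by
  obtain ⟨t, rfl⟩ := h
  exact ⟨substWord t, by simp [substWord]⟩

theorem iter_prefix_succ (n : ℕ) : substWord^[n] [a] <+: substWord^[n + 1] [a] := by
  induction n with
  | zero => exact ⟨[c, a], rfl⟩
  | succ n ih =>
    rw [Function.iterate_succ_apply' substWord n, Function.iterate_succ_apply' substWord (n + 1)]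
    exact substWord_prefix ih

theorem iter_prefix {m n : ℕ} (h : m ≤ n) : substWord^[m] [a] <+: substWord^[n] [a] := by
  induction n, h using Nat.le_induction with
  | base => exact List.prefix_rfl
  | succ n _ ih => exact ih.trans (iter_prefix_succ n)

theorem iter_head (n : ℕ) : ∃ t, substWord^[n] [a] = a :: t := by
  obtain ⟨t, ht⟩ := iter_prefix (Nat.zero_le n)
  exact ⟨t, by simpa using ht.symm⟩

theorem lt_length_iter (n : ℕ) : n < (substWord^[n] [a]).length := by
  induction n with
  | zero => simp
  | succ n ih =>
    obtain ⟨t, ht⟩ := iter_head n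
    rw [Function.iterate_succ_apply']
    rw [ht] at ih ⊢
    have h := length_le_substWord t
    simp only [substWord, List.flatMap_cons, List.length_append, List.length_cons, subst,
      List.length_nil] at ih h ⊢
    omega

theorem getD_of_prefix {u w : List Letter} (h : u <+: w) {i : ℕ} (hi : i < u.length) :
    u.getD i a = w.getD i a := by
  obtain ⟨t, rfl⟩ := h
  rw [List.getD_append _ _ _ _ hi]

/-- The iterates of the substitution on `a` are beginnings of `ξ`. -/
theorem iter_getD (n i : ℕ) (hi : i < (substWord^[n] [a]).length) :
    (substWord^[n] [a]).getD i a = xi i := by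
  rcases le_total n i with h | h
  · exact getD_of_prefix (iter_prefix h) hi
  · exact (getD_of_prefix (iter_prefix h) (lt_length_iter i)).symm

theorem ofFn_prefix {x : ℕ → Letter} {w : List Letter} {m : ℕ} (hm : m ≤ w.length)
    (hw : ∀ i, i < w.length → w.getD i a = x i) : (List.ofFn fun i : Fin m => x i) <+: w := by
  rw [List.prefix_iff_eq_take]
  apply List.ext_getElem
  · simp [hm]
  · intro i h1 h2
    have hi : i < w.length := by simp at h1; omega
    have := hw i hi
    rw [List.getD_eq_getElem _ _ hi] at this
    simp [this]

theorem prefix_ofFn {x : ℕ → Letter} {w : List Letter} {m : ℕ} (hm : w.length ≤ m)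
    (hw : ∀ i, i < w.length → w.getD i a = x i) : w <+: List.ofFn fun i : Fin m => x i := by
  rw [List.prefix_iff_eq_take]
  apply List.ext_getElem
  · simp [hm]
  · intro i h1 h2
    have := hw i h1
    rw [List.getD_eq_getElem _ _ h1] at this
    simp [this]

/-- If `w` is a beginning of `x`, then the image of `w` is a beginning of the image of `x`. -/
theorem substWord_getD {x : ℕ → Letter} {w : List Letter}
    (hw : ∀ i, i < w.length → w.getD i a = x i) (i : ℕ) (hi : i < (substWord w).length) :
    (substWord w).getD i a = substSeq x i := by
  have hlen := length_le_substWord (List.ofFn fun j : Fin (i + 1) => x j)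
  rw [List.length_ofFn] at hlen
  rcases le_total (i + 1) w.length with h | h
  · exact (getD_of_prefix (substWord_prefix (ofFn_prefix h hw)) (by omega)).symm
  · exact getD_of_prefix (substWord_prefix (prefix_ofFn h hw)) hi

/-- `ξ` is the unique infinite word fixed by the substitution. -/
theorem substSeq_eq_self_iff (x : ℕ → Letter) : substSeq x = x ↔ x = xi := by
  constructor
  · intro hx
    have h0 : x 0 = a := by
      have h := congrFun hx 0
      cases h' : x 0 <;> simp [substSeq, substWord, subst, h'] at h ⊢
    have key : ∀ n i, i < (substWord^[n] [a]).length → (substWord^[n] [a]).getD i a = x i := by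
      intro n
      induction n with
      | zero =>
        intro i hi
        have : i = 0 := by simpa using hi
        subst this
        simp [h0]
      | succ n ih =>
        intro i hi
        rw [Function.iterate_succ_apply'] at hi ⊢
        rw [substWord_getD ih i hi, hx]
    funext n
    exact (key n n (lt_length_iter n)).symm
  · rintro rfl
    funext n
    have hn : n < (substWord^[n + 1] [a]).length := (Nat.lt_succ_self n).trans (lt_length_iter _)
    have h1 := iter_getD (n + 1) n hn
    rw [Function.iterate_succ_apply'] at h1 hn
    rw [← h1, substWord_getD (fun i hi => iter_getD n i hi) n hn]

/-- The substitution preserves the words in which `a` alternates with the other letters. -/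
theorem substWord_alternating (w : List Letter)
    (hw : w.IsChain fun x y => (x = a ↔ y ≠ a)) :
    (substWord w).IsChain fun x y => (x = a ↔ y ≠ a) := by
  induction w with
  | nil => simp [substWord]
  | cons x w ih =>
    cases w with
    | nil => cases x <;> simp [substWord, subst]
    | cons y w =>
      rw [List.isChain_cons_cons] at hw
      have h := ih hw.2
      have h1 := hw.1
      cases x <;> cases y <;> first
        | exact absurd h1 (by decide)
        | (simp only [substWord, subst, List.flatMap_cons, List.cons_append, List.nil_append,
            List.isChain_cons_cons] at h ⊢
           refine' ⟨by decide, ?_⟩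
           first | exact h | exact ⟨by decide, by decide, h⟩)

theorem iter_alternating (n : ℕ) :
    (substWord^[n] [a]).IsChain fun x y => (x = a ↔ y ≠ a) := by
  induction n with
  | zero => simp
  | succ n ih =>
    rw [Function.iterate_succ_apply']
    exact substWord_alternating _ ih

/-- There are no double letters in `ξ`. -/
theorem xi_succ_ne (n : ℕ) : xi n ≠ xi (n + 1) := by
  have h := iter_alternating (n + 1)
  have hn := lt_length_iter (n + 1)
  rw [List.isChain_iff_getElem] at h
  have h1 := h n hn
  rw [← List.getD_eq_getElem _ a, ← List.getD_eq_getElem _ a, iter_getD _ _ (by omega),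
    iter_getD _ _ hn] at h1
  intro he
  rw [he] at h1
  tauto

/-! ## The subshift generated by `ξ` -/

/-- The phase space `Ω`: bi-infinite words all of whose finite subwords occur in `ξ`. It carries
the topology induced from the product topology on `ℤ → Letter`. -/
def Omega : Set (ℤ → Letter) :=
  {ω | ∀ (l : ℤ) (n : ℕ), ∃ k : ℕ, ∀ i : ℕ, i < n → ω (l + i) = xi (k + i)}

theorem shift_mem_Omega {ω : ℤ → Letter} (hω : ω ∈ Omega) (m : ℤ) :
    (fun n => ω (n + m)) ∈ Omega := by
  intro l n
  obtain ⟨k, hk⟩ := hω (l + m) n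
  refine ⟨k, fun i hi => ?_⟩
  rw [← hk i hi]
  exact congrArg ω (by ring)

/-- The shift `T : Ω → Ω`, `(T ω)_n = ω_{n+1}`, as a homeomorphism. -/
def T : Omega ≃ₜ Omega where
  toFun ω := ⟨fun n => ω.1 (n + 1), shift_mem_Omega ω.2 1⟩
  invFun ω := ⟨fun n => ω.1 (n + -1), shift_mem_Omega ω.2 (-1)⟩
  left_inv ω := by
    apply Subtype.ext
    funext n
    simp
  right_inv ω := by
    apply Subtype.ext
    funext n
    simp
  continuous_toFun :=
    Continuous.subtype_mk (continuous_pi fun n =>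
      (continuous_apply (A := fun _ : ℤ => Letter) (n + 1)).comp continuous_subtype_val) _
  continuous_invFun :=
    Continuous.subtype_mk (continuous_pi fun n =>
      (continuous_apply (A := fun _ : ℤ => Letter) (n + -1)).comp continuous_subtype_val) _

/-- The cylinder `[u.w]`: with `M`, `N` the lengths of `u`, `w`, all `ω ∈ Ω` such that
`ω_{-M+1} … ω_{-1} ω_0 = u` and `ω_1 ω_2 … ω_N = w`. -/
def cylinder (u w : List Letter) : Set Omega :=
  {ω | (∀ i : Fin u.length, ω.1 (-(u.length : ℤ) + 1 + (i : ℕ)) = u.get i) ∧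
    ∀ i : Fin w.length, ω.1 (1 + (i : ℕ)) = w.get i}

theorem isClopen_cylinder (u w : List Letter) : IsClopen (cylinder u w) := by
  have h (n : ℤ) (l : Letter) : IsClopen {ω : Omega | ω.1 n = l} :=
    (isClopen_discrete {l}).preimage ((continuous_apply n).comp continuous_subtype_val)
  have : cylinder u w =
      (⋂ i : Fin u.length, {ω : Omega | ω.1 (-(u.length : ℤ) + 1 + (i : ℕ)) = u.get i}) ∩
        ⋂ i : Fin w.length, {ω : Omega | ω.1 (1 + (i : ℕ)) = w.get i} := by
    ext ω
    simp [cylinder]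
  rw [this]
  exact (isClopen_iInter_of_finite fun i => h _ _).inter (isClopen_iInter_of_finite fun i => h _ _)

theorem Omega_succ_ne (ω : Omega) (n : ℤ) : ω.1 n ≠ ω.1 (n + 1) := by
  obtain ⟨k, hk⟩ := ω.2 n 2
  have h0 := hk 0 (by norm_num)
  have h1 := hk 1 (by norm_num)
  simp only [Nat.cast_zero, add_zero, Nat.cast_one] at h0 h1
  rw [h0, h1]
  exact xi_succ_ne k

theorem disjoint_cylinder (u w : List Letter) (h : u ≠ [] ∨ w ≠ []) :
    Disjoint (cylinder u w) (T '' cylinder u w) := by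
  rw [Set.disjoint_left]
  rintro _ hω ⟨ω, hω', rfl⟩
  rcases h with h | h
  · have hl := List.length_pos_iff.2 h
    have h1 : ω.1 (-(u.length : ℤ) + 1 + (0 : ℕ) + 1) = u.get ⟨0, hl⟩ := hω.1 ⟨0, hl⟩
    have h2 := hω'.1 ⟨0, hl⟩
    exact Omega_succ_ne ω _ (h2.trans (Eq.symm h1))
  · have hl := List.length_pos_iff.2 h
    have h1 : ω.1 (1 + ((0 : ℕ) : ℤ) + 1) = w.get ⟨0, hl⟩ := hω.2 ⟨0, hl⟩
    have h2 := hω'.2 ⟨0, hl⟩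
    exact Omega_succ_ne ω _ (h2.trans (Eq.symm h1))

/-- The transformation `δ_{[u.w]}`, for words `u` and `w` that are not both empty. -/
noncomputable def deltaCylinder (u w : List Letter) (h : u ≠ [] ∨ w ≠ []) : Omega ≃ₜ Omega :=
  delta T (cylinder u w) (isClopen_cylinder u w) (disjoint_cylinder u w h)

end Lysenok

/-! Let `H` be the generated subgroup. The proof has two halves: `H` contains `δ_U` for every clopen
`U` disjoint from `T(U)`, and every element of `[[T]]` is a product of a power of `T` and finitely
many such `δ_U`.

For the first half, `ξ` is a Toeplitz word: the letter at a position counted from 1 depends only on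
the 2-adic valuation of the position, being `a` for valuation 0 and then `c`, `b`, `d` cyclically
(`xi_toeplitz`). Hence `Ω` carries a nested family of clopen sets `base n`, with return times
exactly the multiples of `2 ^ n`, on which all coordinates not divisible by `2 ^ n` are prescribed.
Fixing also the letter at the origin gives the sets `pointed n x`. Every clopen set is a finite
disjoint union of translates of these for one large `n`. As `δ` turns disjoint unions into products
and translation is conjugation by `T`, only `δ` of `pointed n x` is needed. This goes by induction
on `n` (`deltaMem_pointed_succ`). Products of `δ`'s on overlapping levels give 3-cycles over
intersections, conjugates of a 3-cycle telescope to `δ_P δ_Q` for a distant translate `Q` of `P`,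
and known factors then cancel from a known `δ`. The three generators other than `T` start the
induction at `n = 2`.

For the second half (`IsTower.mem_of_displacement`), take a tower so tall that `f` moves points
little compared with its height and has constant displacement on each level near the base. Composing
with a permutation of levels and a power of `T` yields a map that sends each half-orbit starting at
the base to itself. Such a map permutes the levels of each column, so it is a product of adjacent
transpositions of levels, which are maps `δ_U`. -/

section DeltaSets

/-! ### Calculus of the involutions `δ_U`: disjoint unions and translates -/

variable {X : Type*} [TopologicalSpace X]

/-- The transformation `δ_U` is defined and belongs to the subgroup `H`. -/
def DeltaMem (T : X ≃ₜ X) (H : Subgroup (X ≃ₜ X)) (U : Set X) : Prop :=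
  ∃ (hU : IsClopen U) (hd : Disjoint U (T '' U)), delta T U hU hd ∈ H

theorem disjoint_image_iff {T : X ≃ₜ X} {U : Set X} :
    Disjoint U (T '' U) ↔ ∀ x ∈ U, T x ∉ U := by
  rw [Set.disjoint_right]
  simp

open Classical in
theorem delta_apply {T : X ≃ₜ X} {U : Set X} (hU : IsClopen U) (hd : Disjoint U (T '' U)) (x : X) :
    delta T U hU hd x = if x ∈ U then T x else if T.symm x ∈ U then T.symm x else x := by
  have h : x ∈ T '' U ↔ T.symm x ∈ U := by
    constructor
    · rintro ⟨y, hy, rfl⟩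
      simpa using hy
    · exact fun h => ⟨_, h, by simp⟩
  change deltaFun T U x = _
  simp only [deltaFun, h]

theorem delta_apply_self {T : X ≃ₜ X} {U : Set X} (hU : IsClopen U) (hd : Disjoint U (T '' U))
    (x : X) : delta T U hU hd (delta T U hU hd x) = x :=
  deltaFun_involutive T U hd x

theorem delta_mul_self {T : X ≃ₜ X} {U : Set X} (hU : IsClopen U) (hd : Disjoint U (T '' U)) :
    delta T U hU hd * delta T U hU hd = 1 :=
  Homeomorph.ext fun x => delta_apply_self hU hd x

theorem delta_inv {T : X ≃ₜ X} {U : Set X} (hU : IsClopen U) (hd : Disjoint U (T '' U)) :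
    (delta T U hU hd)⁻¹ = delta T U hU hd :=
  inv_eq_of_mul_eq_one_left (delta_mul_self hU hd)

/-- The sets `A`, `T(A)`, `B`, `T(B)` are pairwise disjoint, so the two involutions have disjoint
supports. -/
theorem delta_union {T : X ≃ₜ X} {A B : Set X} (hA : IsClopen A) (hA' : Disjoint A (T '' A))
    (hB : IsClopen B) (hB' : Disjoint B (T '' B)) (hAB : Disjoint A B)
    (hU : IsClopen (A ∪ B)) (hd : Disjoint (A ∪ B) (T '' (A ∪ B))) :
    delta T (A ∪ B) hU hd = delta T A hA hA' * delta T B hB hB' := by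
  rw [disjoint_image_iff] at *
  rw [Set.disjoint_left] at hAB
  ext x
  have h1 := hd x
  have h2 := hd (T.symm x)
  have h3 := hd (T.symm (T.symm x))
  have h4 := @hAB x
  have h5 := @hAB (T.symm x)
  simp only [T.apply_symm_apply, Set.mem_union] at h1 h2 h3
  simp only [Homeomorph.mul_apply, delta_apply, Set.mem_union]
  by_cases a1 : x ∈ A <;> by_cases a2 : x ∈ B <;> by_cases a3 : T.symm x ∈ A <;>
    by_cases a4 : T.symm x ∈ B <;> simp_all

theorem disjoint_image_mono {T : X ≃ₜ X} {A B : Set X} (h : A ⊆ B) (hB : Disjoint B (T '' B)) :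
    Disjoint A (T '' A) :=
  hB.mono h (Set.image_mono h)

theorem DeltaMem.union {T : X ≃ₜ X} {H : Subgroup (X ≃ₜ X)} {A B : Set X} (hA : DeltaMem T H A)
    (hB : DeltaMem T H B) (hAB : Disjoint A B) (hd : Disjoint (A ∪ B) (T '' (A ∪ B))) :
    DeltaMem T H (A ∪ B) := by
  obtain ⟨hA, hA', hA''⟩ := hA
  obtain ⟨hB, hB', hB''⟩ := hB
  refine ⟨hA.union hB, hd, ?_⟩
  rw [delta_union hA hA' hB hB' hAB]
  exact H.mul_mem hA'' hB''

/-- Cancellation of a known factor; this is how new `δ`'s are split off in the induction. -/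
theorem DeltaMem.of_union {T : X ≃ₜ X} {H : Subgroup (X ≃ₜ X)} {A B : Set X} (hA : DeltaMem T H A)
    (hB : IsClopen B) (hAB : Disjoint A B) (hU : DeltaMem T H (A ∪ B)) :
    DeltaMem T H B := by
  obtain ⟨hA, hA', hA''⟩ := hA
  obtain ⟨hU, hd, hU''⟩ := hU
  have hB' : Disjoint B (T '' B) := disjoint_image_mono Set.subset_union_right hd
  refine ⟨hB, hB', ?_⟩
  rw [delta_union hA hA' hB hB' hAB] at hU''
  exact (H.mul_mem_cancel_left hA'').1 hU''

theorem DeltaMem.empty (T : X ≃ₜ X) (H : Subgroup (X ≃ₜ X)) : DeltaMem T H ∅ := by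
  refine ⟨isClopen_empty, Set.empty_disjoint _, ?_⟩
  have : delta T ∅ isClopen_empty (Set.empty_disjoint _) = 1 := by
    ext x
    simp [delta_apply]
  rw [this]
  exact H.one_mem

theorem commute_zpow_apply (T : X ≃ₜ X) (j : ℤ) (x : X) : (T ^ j) (T x) = T ((T ^ j) x) := by
  have h : T ^ j * T = T * T ^ j := (Commute.zpow_self T j).eq
  exact congrArg (fun f : X ≃ₜ X => f x) h

theorem commute_zpow_symm_apply (T : X ≃ₜ X) (j : ℤ) (x : X) :
    (T ^ j) (T.symm x) = T.symm ((T ^ j) x) := by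
  rw [T.eq_symm_apply, ← commute_zpow_apply, T.apply_symm_apply]

theorem zpow_neg_apply_zpow (T : X ≃ₜ X) (j : ℤ) (x : X) : (T ^ (-j)) ((T ^ j) x) = x := by
  rw [← Homeomorph.mul_apply, ← zpow_add]
  simp

theorem zpow_apply_zpow (T : X ≃ₜ X) (i j : ℤ) (x : X) :
    (T ^ i) ((T ^ j) x) = (T ^ (i + j)) x := by
  rw [zpow_add, Homeomorph.mul_apply]

theorem isClopen_zpow_preimage {T : X ≃ₜ X} {U : Set X} (hU : IsClopen U) (j : ℤ) :
    IsClopen ((T ^ j) ⁻¹' U) :=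
  hU.preimage (T ^ j).continuous

theorem disjoint_zpow_preimage {T : X ≃ₜ X} {U : Set X} (hd : Disjoint U (T '' U)) (j : ℤ) :
    Disjoint ((T ^ j) ⁻¹' U) (T '' ((T ^ j) ⁻¹' U)) := by
  rw [disjoint_image_iff] at *
  intro x hx
  rw [Set.mem_preimage, commute_zpow_apply]
  exact hd _ hx

theorem delta_zpow_preimage {T : X ≃ₜ X} {U : Set X} (hU : IsClopen U) (hd : Disjoint U (T '' U))
    (j : ℤ) : delta T ((T ^ j) ⁻¹' U) (isClopen_zpow_preimage hU j) (disjoint_zpow_preimage hd j) =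
      T ^ (-j) * delta T U hU hd * T ^ j := by
  ext x
  have m1 : x ∈ (T ^ j) ⁻¹' U ↔ (T ^ j) x ∈ U := Iff.rfl
  have m2 : T.symm x ∈ (T ^ j) ⁻¹' U ↔ T.symm ((T ^ j) x) ∈ U := by
    rw [Set.mem_preimage, commute_zpow_symm_apply]
  rw [delta_apply (isClopen_zpow_preimage hU j), Homeomorph.mul_apply, Homeomorph.mul_apply,
    delta_apply hU]
  by_cases h1 : (T ^ j) x ∈ U
  · rw [if_pos (m1.2 h1), if_pos h1, commute_zpow_apply, zpow_neg_apply_zpow]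
  · rw [if_neg (mt m1.1 h1), if_neg h1]
    by_cases h2 : T.symm ((T ^ j) x) ∈ U
    · rw [if_pos (m2.2 h2), if_pos h2, commute_zpow_symm_apply, zpow_neg_apply_zpow]
    · rw [if_neg (mt m2.1 h2), if_neg h2, zpow_neg_apply_zpow]

theorem DeltaMem.zpow_preimage {T : X ≃ₜ X} {H : Subgroup (X ≃ₜ X)} (hT : T ∈ H) {U : Set X}
    (hU : DeltaMem T H U) (j : ℤ) : DeltaMem T H ((T ^ j) ⁻¹' U) := by
  obtain ⟨hU, hd, h⟩ := hU
  refine ⟨isClopen_zpow_preimage hU j, disjoint_zpow_preimage hd j, ?_⟩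
  rw [delta_zpow_preimage hU hd]
  exact H.mul_mem (H.mul_mem (H.zpow_mem hT _) h) (H.zpow_mem hT _)

theorem zpow_neg_preimage_preimage (T : X ≃ₜ X) (U : Set X) (j : ℤ) :
    (T ^ (-j)) ⁻¹' ((T ^ j) ⁻¹' U) = U := by
  ext x
  rw [Set.mem_preimage, Set.mem_preimage, zpow_apply_zpow]
  simp

theorem DeltaMem.of_zpow_preimage {T : X ≃ₜ X} {H : Subgroup (X ≃ₜ X)} (hT : T ∈ H) {U : Set X}
    (j : ℤ) (hU : DeltaMem T H ((T ^ j) ⁻¹' U)) : DeltaMem T H U := by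
  have := hU.zpow_preimage hT (-j)
  rwa [zpow_neg_preimage_preimage] at this

end DeltaSets

/-! ### 3-cycles on consecutive levels -/

section ThreeCycles

variable {X : Type*} [TopologicalSpace X]

/-- The product of the involutions on `U ∪ T(U)` and `T(U) ∪ T²(U)`. -/
noncomputable def cycleThree (T : X ≃ₜ X) (U : Set X) (hU : IsClopen U)
    (hd : Disjoint U (T '' U)) : X ≃ₜ X :=
  delta T U hU hd * delta T ((T ^ (-1 : ℤ)) ⁻¹' U) (isClopen_zpow_preimage hU (-1))
    (disjoint_zpow_preimage hd (-1))

/-- `x` and its two next iterates are in different levels over `D`. -/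
def ThreeLevels (T : X ≃ₜ X) (D : Set X) : Prop :=
  ∀ x ∈ D, T x ∉ D ∧ T (T x) ∉ D

theorem ThreeLevels.disjoint {T : X ≃ₜ X} {D U : Set X} (hD : ThreeLevels T D) (h : U ⊆ D) :
    Disjoint U (T '' U) :=
  disjoint_image_iff.2 fun x hx hx' => (hD x (h hx)).1 (h hx')

theorem ThreeLevels.symm_notMem {T : X ≃ₜ X} {D : Set X} (hD : ThreeLevels T D) {y : X}
    (hy : y ∈ D) : T.symm y ∉ D ∧ T.symm (T.symm y) ∉ D := by
  constructor
  · intro h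
    have := (hD _ h).1
    rw [T.apply_symm_apply] at this
    exact this hy
  · intro h
    have := (hD _ h).2
    rw [T.apply_symm_apply, T.apply_symm_apply] at this
    exact this hy

open Classical in
theorem delta_levels {T : X ≃ₜ X} {D U : Set X} (hD : ThreeLevels T D) (h : U ⊆ D)
    (hU : IsClopen U) (hd : Disjoint U (T '' U)) {y : X} (hy : y ∈ D) :
    delta T U hU hd y = (if y ∈ U then T y else y) ∧
    delta T U hU hd (T y) = (if y ∈ U then y else T y) ∧
    delta T U hU hd (T (T y)) = T (T y) := by
  have h1 : T.symm y ∉ U := fun h' => (hD.symm_notMem hy).1 (h h')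
  have h2 : T y ∉ U := fun h' => (hD y hy).1 (h h')
  have h3 : T (T y) ∉ U := fun h' => (hD y hy).2 (h h')
  refine ⟨?_, ?_, ?_⟩ <;> simp [delta_apply, h1, h2, h3]

theorem zpow_neg_one_apply (T : X ≃ₜ X) (x : X) : (T ^ (-1 : ℤ)) x = T.symm x := by
  rw [zpow_neg_one]
  simp

open Classical in
theorem delta_shift_levels {T : X ≃ₜ X} {D U : Set X} (hD : ThreeLevels T D) (h : U ⊆ D)
    (hU : IsClopen ((T ^ (-1 : ℤ)) ⁻¹' U))
    (hd : Disjoint ((T ^ (-1 : ℤ)) ⁻¹' U) (T '' ((T ^ (-1 : ℤ)) ⁻¹' U))) {y : X} (hy : y ∈ D) :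
    delta T ((T ^ (-1 : ℤ)) ⁻¹' U) hU hd y = y ∧
    delta T ((T ^ (-1 : ℤ)) ⁻¹' U) hU hd (T y) = (if y ∈ U then T (T y) else T y) ∧
    delta T ((T ^ (-1 : ℤ)) ⁻¹' U) hU hd (T (T y)) = (if y ∈ U then T y else T (T y)) := by
  have h1 : T.symm y ∉ U := fun h' => (hD.symm_notMem hy).1 (h h')
  have h1' : T.symm (T.symm y) ∉ U := fun h' => (hD.symm_notMem hy).2 (h h')
  have h2 : T y ∉ U := fun h' => (hD y hy).1 (h h')
  refine ⟨?_, ?_, ?_⟩ <;> simp [delta_apply, h1, h2, h1']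

theorem delta_eq_self {T : X ≃ₜ X} {U : Set X} (hU : IsClopen U) (hd : Disjoint U (T '' U)) {x : X}
    (h1 : x ∉ U) (h2 : T.symm x ∉ U) : delta T U hU hd x = x := by
  simp [delta_apply, h1, h2]

/-- A point is on one of the three levels over `D`, or fixed by everything living there. -/
theorem base_level_cases (T : X ≃ₜ X) (D : Set X) (x : X) :
    (∃ y ∈ D, x = y ∨ x = T y ∨ x = T (T y)) ∨
      (x ∉ D ∧ T.symm x ∉ D ∧ T.symm (T.symm x) ∉ D) := by
  by_cases h1 : x ∈ D
  · exact Or.inl ⟨x, h1, Or.inl rfl⟩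
  by_cases h2 : T.symm x ∈ D
  · exact Or.inl ⟨_, h2, by simp⟩
  by_cases h3 : T.symm (T.symm x) ∈ D
  · exact Or.inl ⟨_, h3, by simp⟩
  exact Or.inr ⟨h1, h2, h3⟩

/-- Over `V ∩ W` the product of the two adjacent transpositions is a 3-cycle, equal to its own
fourth power. Over the rest of `V ∪ W` only one transposition acts, and the fourth power kills it.
-/
theorem cycleThree_inter {T : X ≃ₜ X} {D V W : Set X} (hD : ThreeLevels T D) (hVD : V ⊆ D)
    (hWD : W ⊆ D) (hV : IsClopen V) (hW : IsClopen W) :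
    cycleThree T (V ∩ W) (hV.inter hW) (hD.disjoint (Set.inter_subset_left.trans hVD)) =
      (delta T V hV (hD.disjoint hVD) * delta T ((T ^ (-1 : ℤ)) ⁻¹' W)
        (isClopen_zpow_preimage hW (-1)) (disjoint_zpow_preimage (hD.disjoint hWD) (-1))) ^ 4 := by
  ext x
  have hPD : V ∩ W ⊆ D := Set.inter_subset_left.trans hVD
  simp only [cycleThree, pow_succ, pow_zero, one_mul, Homeomorph.mul_apply]
  rcases base_level_cases T D x with ⟨y, hy, h⟩ | ⟨h1, h2, h3⟩
  · obtain ⟨v0, v1, v2⟩ := delta_levels hD hVD hV (hD.disjoint hVD) hy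
    obtain ⟨w0, w1, w2⟩ := delta_shift_levels hD hWD (isClopen_zpow_preimage hW (-1))
      (disjoint_zpow_preimage (hD.disjoint hWD) (-1)) hy
    obtain ⟨p0, p1, p2⟩ := delta_levels hD hPD (hV.inter hW) (hD.disjoint hPD) hy
    obtain ⟨q0, q1, q2⟩ := delta_shift_levels hD hPD (isClopen_zpow_preimage (hV.inter hW) (-1))
      (disjoint_zpow_preimage (hD.disjoint hPD) (-1)) hy
    by_cases a1 : y ∈ V <;> by_cases a2 : y ∈ W <;>
      simp only [Set.mem_inter_iff, a1, a2, and_true, and_false, if_true, if_false] at * <;>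
      rcases h with rfl | rfl | rfl <;> simp only [v0, v1, v2, w0, w1, w2, p0, p1, p2, q0, q1, q2]
  · have e1 : ∀ {U : Set X} (hU : IsClopen U) (hd : Disjoint U (T '' U)), U ⊆ D →
        delta T U hU hd x = x := fun hU hd h =>
      delta_eq_self hU hd (fun h' => h1 (h h')) (fun h' => h2 (h h'))
    have e2 : ∀ {U : Set X} (hU : IsClopen ((T ^ (-1 : ℤ)) ⁻¹' U))
        (hd : Disjoint ((T ^ (-1 : ℤ)) ⁻¹' U) (T '' ((T ^ (-1 : ℤ)) ⁻¹' U))), U ⊆ D →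
        delta T ((T ^ (-1 : ℤ)) ⁻¹' U) hU hd x = x := fun hU hd h =>
      delta_eq_self hU hd (fun h' => h2 (h (by simpa [zpow_neg_one_apply] using h')))
        (fun h' => h3 (h (by simpa [zpow_neg_one_apply] using h')))
    simp only [e1 _ _ hPD, e1 _ _ hVD, e2 _ _ hPD, e2 _ _ hWD]

/-- A transposition `t` inverts a 3-cycle `c` on the same three levels, so the commutator `c t c⁻¹
t` is `c ^ 2`, with square `c ^ 4 = c`. Where only one of the two acts, the commutator is trivial.
-/
theorem cycleThree_inter_eq_commutator {T : X ≃ₜ X} {D V W : Set X} (hD : ThreeLevels T D) (hVD : V ⊆ D)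
    (hWD : W ⊆ D) (hV : IsClopen V) (hW : IsClopen W) :
    cycleThree T (V ∩ W) (hV.inter hW) (hD.disjoint (Set.inter_subset_left.trans hVD)) =
      (cycleThree T V hV (hD.disjoint hVD) * delta T ((T ^ (-1 : ℤ)) ⁻¹' W)
        (isClopen_zpow_preimage hW (-1)) (disjoint_zpow_preimage (hD.disjoint hWD) (-1)) *
        (cycleThree T V hV (hD.disjoint hVD))⁻¹ * delta T ((T ^ (-1 : ℤ)) ⁻¹' W)
        (isClopen_zpow_preimage hW (-1)) (disjoint_zpow_preimage (hD.disjoint hWD) (-1))) ^ 2 := by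
  ext x
  have hPD : V ∩ W ⊆ D := Set.inter_subset_left.trans hVD
  simp only [cycleThree, pow_succ, pow_zero, one_mul, mul_inv_rev, delta_inv,
    Homeomorph.mul_apply]
  rcases base_level_cases T D x with ⟨y, hy, h⟩ | ⟨h1, h2, h3⟩
  · obtain ⟨v0, v1, v2⟩ := delta_levels hD hVD hV (hD.disjoint hVD) hy
    obtain ⟨u0, u1, u2⟩ := delta_shift_levels hD hVD (isClopen_zpow_preimage hV (-1))
      (disjoint_zpow_preimage (hD.disjoint hVD) (-1)) hy
    obtain ⟨w0, w1, w2⟩ := delta_shift_levels hD hWD (isClopen_zpow_preimage hW (-1))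
      (disjoint_zpow_preimage (hD.disjoint hWD) (-1)) hy
    obtain ⟨p0, p1, p2⟩ := delta_levels hD hPD (hV.inter hW) (hD.disjoint hPD) hy
    obtain ⟨q0, q1, q2⟩ := delta_shift_levels hD hPD (isClopen_zpow_preimage (hV.inter hW) (-1))
      (disjoint_zpow_preimage (hD.disjoint hPD) (-1)) hy
    by_cases a1 : y ∈ V <;> by_cases a2 : y ∈ W <;>
      simp only [Set.mem_inter_iff, a1, a2, and_true, and_false, if_true, if_false] at * <;>
      rcases h with rfl | rfl | rfl <;>
      simp only [v0, v1, v2, u0, u1, u2, w0, w1, w2, p0, p1, p2, q0, q1, q2]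
  · have e1 : ∀ {U : Set X} (hU : IsClopen U) (hd : Disjoint U (T '' U)), U ⊆ D →
        delta T U hU hd x = x := fun hU hd h =>
      delta_eq_self hU hd (fun h' => h1 (h h')) (fun h' => h2 (h h'))
    have e2 : ∀ {U : Set X} (hU : IsClopen ((T ^ (-1 : ℤ)) ⁻¹' U))
        (hd : Disjoint ((T ^ (-1 : ℤ)) ⁻¹' U) (T '' ((T ^ (-1 : ℤ)) ⁻¹' U))), U ⊆ D →
        delta T ((T ^ (-1 : ℤ)) ⁻¹' U) hU hd x = x := fun hU hd h =>
      delta_eq_self hU hd (fun h' => h2 (h (by simpa [zpow_neg_one_apply] using h')))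
        (fun h' => h3 (h (by simpa [zpow_neg_one_apply] using h')))
    simp only [e1 _ _ hPD, e1 _ _ hVD, e2 _ _ hPD, e2 _ _ hWD, e2 _ _ hVD]

/-- If `δ_V`, `δ_W`, `δ_Z` are in `H`, then so is the 3-cycle on the levels over `V ∩ W ∩ Z`. -/
theorem cycleThree_mem {T : X ≃ₜ X} {H : Subgroup (X ≃ₜ X)} (hT : T ∈ H) {D V W Z : Set X}
    (hD : ThreeLevels T D) (hVD : V ⊆ D) (hWD : W ⊆ D) (hZD : Z ⊆ D) (hV : DeltaMem T H V)
    (hW : DeltaMem T H W) (hZ : DeltaMem T H Z) (hU : IsClopen (V ∩ W ∩ Z))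
    (hd : Disjoint (V ∩ W ∩ Z) (T '' (V ∩ W ∩ Z))) :
    cycleThree T (V ∩ W ∩ Z) hU hd ∈ H := by
  obtain ⟨_, _, hW'⟩ := hW.zpow_preimage hT (-1)
  obtain ⟨_, _, hZ'⟩ := hZ.zpow_preimage hT (-1)
  obtain ⟨hV1, _, hV'⟩ := hV
  have h1 := cycleThree_inter hD hVD hWD hV1 hW.1
  have h2 := cycleThree_inter_eq_commutator hD (Set.inter_subset_left.trans hVD : V ∩ W ⊆ D) hZD
    (hV1.inter hW.1) hZ.1
  have h3 := H.pow_mem (H.mul_mem hV' hW') 4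
  rw [← h1] at h3
  rw [h2]
  exact H.pow_mem (H.mul_mem (H.mul_mem (H.mul_mem h3 hZ') (H.inv_mem h3)) hZ') 2

/-- With `dₙ = t⁻ⁿ d tⁿ`, this is `d dₙ₊₁ = (d dₙ)(dₙ dₙ₊₁)`, the last factor written as a conjugate
of the inverse of `d d₋₁`. For `d = δ_U` the element `d d₋₁` is the 3-cycle over `U`. -/
theorem involution_conj_step {G : Type*} [Group G] (t d : G) (hd : d⁻¹ = d) (n : ℤ) :
    d * (t ^ (-(n + 1)) * d * t ^ (n + 1)) = d * (t ^ (-n) * d * t ^ n) *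
      (t ^ (-(n + 1)) * (d * (t ^ (-(-1 : ℤ)) * d * t ^ (-1 : ℤ)))⁻¹ * t ^ (n + 1)) := by
  have h : d * (t ^ (-(n + 1)) * d⁻¹ * t ^ (n + 1)) = d * (t ^ (-n) * d * t ^ n) *
      (t ^ (-(n + 1)) * (d * (t ^ (-(-1 : ℤ)) * d * t ^ (-1 : ℤ)))⁻¹ * t ^ (n + 1)) := by
    group
  rwa [hd] at h

/-- If the 3-cycle over `U` is in `H`, then so is `δ_U δ_{T^{-N} U}`. -/
theorem delta_mul_delta_mem {T : X ≃ₜ X} {H : Subgroup (X ≃ₜ X)} (hT : T ∈ H) {U : Set X}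
    (hU : IsClopen U) (hd : Disjoint U (T '' U)) (h : cycleThree T U hU hd ∈ H) (N : ℕ) :
    delta T U hU hd * delta T ((T ^ (N : ℤ)) ⁻¹' U) (isClopen_zpow_preimage hU N)
      (disjoint_zpow_preimage hd N) ∈ H := by
  rw [delta_zpow_preimage hU hd]
  rw [cycleThree, delta_zpow_preimage hU hd] at h
  induction N with
  | zero => simp [delta_mul_self]
  | succ N ih =>
    rw [Nat.cast_add_one, involution_conj_step T _ (delta_inv hU hd)]
    exact H.mul_mem ih (H.mul_mem (H.mul_mem (H.zpow_mem hT _) (H.inv_mem h)) (H.zpow_mem hT _))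

end ThreeCycles

/-! ### Toeplitz structure of `ξ` -/

namespace Lysenok

open Letter

/-- The letter of `ξ` at (1-based) positions with 2-adic valuation `n`. -/
def level : ℕ → Letter
  | 0 => a
  | 1 => c
  | 2 => b
  | 3 => d
  | n + 4 => level (n + 1)

theorem level_cases (n : ℕ) :
    (level (n + 1) = c ∧ level (n + 2) = b ∧ level (n + 3) = d) ∨
    (level (n + 1) = b ∧ level (n + 2) = d ∧ level (n + 3) = c) ∨
    (level (n + 1) = d ∧ level (n + 2) = c ∧ level (n + 3) = b) := by
  induction n with
  | zero => simp [level]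
  | succ n ih =>
    have h : level (n + 1 + 3) = level (n + 1) := by rw [level]
    rw [h]
    rcases ih with ⟨h1, h2, h3⟩ | ⟨h1, h2, h3⟩ | ⟨h1, h2, h3⟩ <;>
      simp [show n + 1 + 1 = n + 2 from rfl, show n + 1 + 2 = n + 3 from rfl, h1, h2, h3]

theorem level_succ_ne_a (n : ℕ) : level (n + 1) ≠ a := by
  rcases level_cases n with ⟨h1, -, -⟩ | ⟨h1, -, -⟩ | ⟨h1, -, -⟩ <;> simp [h1]

theorem level_ne_succ (n : ℕ) : level n ≠ level (n + 1) := by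
  cases n with
  | zero => simp [level]
  | succ n =>
    rcases level_cases n with ⟨h1, h2, -⟩ | ⟨h1, h2, -⟩ | ⟨h1, h2, -⟩ <;>
      simp [show n + 1 + 1 = n + 2 from rfl, h1, h2]

theorem eq_level_of_ne_a (n : ℕ) {x : Letter} (hx : x ≠ a) :
    x = level (n + 1) ∨ x = level (n + 2) ∨ x = level (n + 3) := by
  rcases level_cases n with ⟨h1, h2, h3⟩ | ⟨h1, h2, h3⟩ | ⟨h1, h2, h3⟩ <;>
    rw [h1, h2, h3] <;> cases x <;> simp at hx ⊢

theorem substWord_append (u w : List Letter) :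
    substWord (u ++ w) = substWord u ++ substWord w := by
  simp [substWord]

theorem iter_substWord_append (n : ℕ) (u w : List Letter) :
    substWord^[n] (u ++ w) = substWord^[n] u ++ substWord^[n] w := by
  induction n generalizing u w with
  | zero => rfl
  | succ n ih => rw [Function.iterate_succ_apply, substWord_append, ih]; rfl

theorem substWord_level (n : ℕ) : substWord [level (n + 1)] = [level (n + 2)] := by
  rcases level_cases n with ⟨h1, h2, -⟩ | ⟨h1, h2, -⟩ | ⟨h1, h2, -⟩ <;>
    rw [h1, h2] <;> rfl

theorem iter_substWord_c (n : ℕ) : substWord^[n] [c] = [level (n + 1)] := by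
  induction n with
  | zero => rfl
  | succ n ih => rw [Function.iterate_succ_apply', ih, substWord_level]

/-- Iterating `a ↦ aca` gives three blocks, and `c` runs through the cycle `c ↦ b ↦ d ↦ c`. -/
theorem iter_succ (n : ℕ) :
    substWord^[n + 1] [a] = substWord^[n] [a] ++ ([level (n + 1)] ++ substWord^[n] [a]) := by
  rw [Function.iterate_succ_apply, show substWord [a] = [a] ++ ([c] ++ [a]) from rfl,
    iter_substWord_append, iter_substWord_append, iter_substWord_c]

theorem length_iter (n : ℕ) : (substWord^[n] [a]).length + 1 = 2 ^ (n + 1) := by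
  induction n with
  | zero => rfl
  | succ n ih =>
    rw [iter_succ, List.length_append, List.length_append, List.length_singleton, pow_succ]
    omega

theorem xi_two_pow_sub_one (n : ℕ) : xi (2 ^ n - 1) = level n := by
  cases n with
  | zero => rfl
  | succ n =>
    have h := length_iter n
    have h' := length_iter (n + 1)
    have hp : 2 ^ (n + 1) = 2 * 2 ^ n := pow_succ' 2 n
    have hp' : 2 ^ (n + 1 + 1) = 2 * 2 ^ (n + 1) := pow_succ' 2 (n + 1)
    have h1 : 1 ≤ 2 ^ n := Nat.one_le_two_pow
    rw [← iter_getD (n + 1) _ (by omega), iter_succ, List.getD_append_right _ _ _ _ (by omega)]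
    rw [show 2 ^ (n + 1) - 1 - (substWord^[n] [a]).length = 0 by omega]
    rfl

theorem xi_two_pow_add (n i : ℕ) (hi : i + 1 < 2 ^ n) : xi (2 ^ n + i) = xi i := by
  cases n with
  | zero => simp at hi
  | succ n =>
    have h := length_iter n
    have h' := length_iter (n + 1)
    have hp : 2 ^ (n + 1) = 2 * 2 ^ n := pow_succ' 2 n
    have hp' : 2 ^ (n + 1 + 1) = 2 * 2 ^ (n + 1) := pow_succ' 2 (n + 1)
    rw [← iter_getD (n + 1) _ (by omega), iter_succ, List.getD_append_right _ _ _ _ (by omega),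
      List.getD_append_right _ _ _ _ (by simp; omega)]
    rw [← iter_getD n i (by omega)]
    congr 1
    simp
    omega

/-- `xi` counts from 0, so the position in `ξ` is `k + 1`. Removing the leading binary digit of the
position keeps both the letter (`xi_two_pow_add`) and the valuation, until a power of two remains.
-/
theorem xi_toeplitz (k m u : ℕ) (h : k + 1 = 2 ^ m * (2 * u + 1)) : xi k = level m := by
  induction k using Nat.strong_induction_on generalizing u with
  | _ k ih =>
    rcases Nat.eq_zero_or_pos u with rfl | hu
    · rw [show k = 2 ^ m - 1 by omega]
      exact xi_two_pow_sub_one m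
    · obtain ⟨s, hs, hs'⟩ : ∃ s, 2 ^ s ≤ u ∧ u < 2 ^ (s + 1) :=
        ⟨Nat.log 2 u, Nat.pow_log_le_self 2 hu.ne', Nat.lt_pow_succ_log_self (by norm_num) u⟩
      obtain ⟨v, rfl⟩ := Nat.exists_eq_add_of_le hs
      have hp : 2 ^ (m + s + 1) = 2 ^ m * (2 * 2 ^ s) := by ring
      have hv : 2 ^ m * (2 * v + 1) < 2 ^ (m + s + 1) := by
        rw [hp]
        have := pow_succ' 2 s
        exact Nat.mul_lt_mul_of_pos_left (by omega) (by positivity)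
      have e : 2 ^ m * (2 * (2 ^ s + v) + 1) = 2 ^ (m + s + 1) + 2 ^ m * (2 * v + 1) := by
        rw [hp]; ring
      have hpos : 0 < 2 ^ m * (2 * v + 1) := by positivity
      have hk : k = 2 ^ (m + s + 1) + (2 ^ m * (2 * v + 1) - 1) := by omega
      have hpos' : 0 < 2 ^ (m + s + 1) := by positivity
      rw [hk, xi_two_pow_add _ _ (by omega)]
      exact ih _ (by omega) v (by omega)

/-! ### The nested clopen sets `base n` and their return times -/

theorem T_zpow_apply (j : ℤ) (ω : Omega) (n : ℤ) : ((T ^ j) ω).1 n = ω.1 (n + j) := by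
  induction j generalizing ω n with
  | zero => simp
  | succ i ih =>
    rw [zpow_add_one, Homeomorph.mul_apply, ih]
    change ω.1 (n + i + 1) = _
    rw [add_assoc]
  | pred i ih =>
    rw [zpow_sub_one, Homeomorph.mul_apply, ih]
    exact congrArg ω.1 (by ring : n + -i + -1 = n + (-i - 1))

/-- The sequences with the letters of the Toeplitz structure at all positions not divisible by
`2 ^ n`. -/
def base (n : ℕ) : Set Omega :=
  {ω | ∀ m < n, ∀ u : ℤ, ω.1 (2 ^ m * (2 * u + 1)) = level m}

theorem base_succ_subset (n : ℕ) : base (n + 1) ⊆ base n :=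
  fun _ h m hm u => h m (hm.trans n.lt_succ_self) u

theorem exists_eq_of_not_dvd (n : ℕ) {s : ℤ} (h : ¬ (2 : ℤ) ^ n ∣ s) :
    ∃ m < n, ∃ u : ℤ, s = 2 ^ m * (2 * u + 1) := by
  induction n with
  | zero => simp at h
  | succ n ih =>
    by_cases h' : (2 : ℤ) ^ n ∣ s
    · obtain ⟨q, rfl⟩ := h'
      rcases Int.even_or_odd' q with ⟨u, rfl | rfl⟩
      · exact absurd ⟨u, by ring⟩ h
      · exact ⟨n, n.lt_succ_self, u, rfl⟩
    · obtain ⟨m, hm, u, hu⟩ := ih h'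
      exact ⟨m, hm.trans n.lt_succ_self, u, hu⟩

theorem zpow_mem_base {n : ℕ} {ω : Omega} (h : ω ∈ base n) {s : ℤ} (hs : (2 : ℤ) ^ n ∣ s) :
    (T ^ s) ω ∈ base n := by
  obtain ⟨q, rfl⟩ := hs
  intro m hm u
  rw [T_zpow_apply]
  obtain ⟨e, rfl⟩ := Nat.exists_eq_add_of_lt hm
  rw [← h m hm (u + 2 ^ e * q)]
  exact congrArg ω.1 (by ring)

theorem zpow_mem_base_iff {n : ℕ} {ω : Omega} {s : ℤ} (hs : (2 : ℤ) ^ n ∣ s) :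
    (T ^ s) ω ∈ base n ↔ ω ∈ base n := by
  refine ⟨fun h => ?_, fun h => zpow_mem_base h hs⟩
  have := zpow_mem_base h ((dvd_neg (a := (2 : ℤ) ^ n)).2 hs)
  rwa [zpow_neg_apply_zpow] at this

/-- If every shift failed, the failures for the finitely many residues would be seen in one finite
window of `ω`. That window occurs in `ξ`, whose Toeplitz structure supplies a residue that does not
fail. -/
theorem exists_zpow_mem_base (n : ℕ) (ω : Omega) : ∃ r : ℤ, (T ^ r) ω ∈ base n := by
  by_contra hcon
  have hex : ∀ r : ℤ, ∃ m < n, ∃ u : ℤ, ω.1 (2 ^ m * (2 * u + 1) + r) ≠ level m := by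
    intro r
    by_contra h
    push Not at h
    exact hcon ⟨r, fun m hm u => by rw [T_zpow_apply]; exact h m hm u⟩
  choose m hm u hu using hex
  have hfin : ((fun r : ℤ => |2 ^ m r * (2 * u r + 1) + r|) '' Set.Icc 0 (2 ^ n)).Finite :=
    (Set.finite_Icc _ _).image _
  obtain ⟨L, hL⟩ := hfin.bddAbove
  have hL' : ∀ r : ℤ, 0 ≤ r → r ≤ 2 ^ n → |2 ^ m r * (2 * u r + 1) + r| ≤ L :=
    fun r h1 h2 => hL ⟨r, ⟨h1, h2⟩, rfl⟩
  obtain ⟨l, hl⟩ : ∃ l : ℕ, L ≤ l := ⟨L.toNat, Int.self_le_toNat L⟩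
  obtain ⟨k, hk⟩ := ω.2 (-l) (2 * l + 1)
  -- Coordinate `p` of `ω` in the window is position `k + l + p + 1` of `ξ`, counted from 1; `r`
  -- makes coordinate `r` a multiple of `2 ^ n` there.
  set r : ℤ := (-(k + l + 1)) % 2 ^ n with hr
  have hr0 : 0 ≤ r := Int.emod_nonneg _ (by positivity)
  have hr1 : r < 2 ^ n := Int.emod_lt_of_pos _ (by positivity)
  have h1 := abs_le.1 ((hL' r hr0 hr1.le).trans hl)
  obtain ⟨q, hq⟩ : ∃ q : ℤ, (k + l + 1 : ℤ) + r = 2 ^ n * q := by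
    refine ⟨-(-(k + l + 1) / 2 ^ n), ?_⟩
    have := Int.emod_add_mul_ediv (-(k + l + 1 : ℤ)) (2 ^ n)
    rw [← hr] at this
    linarith
  set p : ℤ := 2 ^ m r * (2 * u r + 1) + r with hp
  have h2 := hk (p + l).toNat (by omega)
  have h3 : (((p + l).toNat : ℕ) : ℤ) = p + l := Int.toNat_of_nonneg (by omega)
  rw [h3, show -(l : ℤ) + (p + l) = p by ring] at h2
  apply hu r
  rw [h2]
  obtain ⟨e, he⟩ := Nat.exists_eq_add_of_lt (hm r)
  have h4 : ((k + (p + l).toNat + 1 : ℕ) : ℤ) = 2 ^ m r * (2 * (u r + 2 ^ e * q) + 1) := by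
    push_cast
    rw [h3, hp]
    have : (2 : ℤ) ^ n = 2 ^ m r * (2 * 2 ^ e) := by rw [he]; ring
    rw [this] at hq
    linear_combination hq
  have h5 : 0 ≤ u r + 2 ^ e * q := by
    by_contra h
    have : 2 ^ m r * (2 * (u r + 2 ^ e * q) + 1) < 0 :=
      mul_neg_of_pos_of_neg (by positivity) (by omega)
    omega
  obtain ⟨v, hv⟩ := Int.eq_ofNat_of_zero_le h5
  refine xi_toeplitz _ _ v ?_
  rw [hv] at h4
  exact_mod_cast h4

/-- If `s` had valuation `m < n`, some coordinate would have valuation `m + 1` seen from the origin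
and `m` seen from `s`. Consecutive levels carry different letters. The case `m = n - 1` needs `base
(n + 1)`. -/
theorem dvd_of_zpow_mem_base_of_mem_succ {n : ℕ} {ω : Omega} {s : ℤ} (h : ω ∈ base (n + 1))
    (hs : (T ^ s) ω ∈ base n) : (2 : ℤ) ^ n ∣ s := by
  by_contra hcon
  obtain ⟨m, hm, u, rfl⟩ := exists_eq_of_not_dvd n hcon
  have h1 := h (m + 1) (by omega) 0
  have h2 := hs m hm (-u)
  rw [T_zpow_apply] at h2
  apply level_ne_succ m
  rw [← h1, ← h2]
  exact congrArg ω.1 (by ring)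

/-- Both points are compared with a third point of the orbit lying in the deeper set `base (n + 1)`.
-/
theorem dvd_of_zpow_mem_base {n : ℕ} {ω : Omega} {s : ℤ} (h : ω ∈ base n)
    (hs : (T ^ s) ω ∈ base n) : (2 : ℤ) ^ n ∣ s := by
  obtain ⟨t, ht⟩ := exists_zpow_mem_base (n + 1) ω
  have h1 : (2 : ℤ) ^ n ∣ -t := dvd_of_zpow_mem_base_of_mem_succ ht
    (by rwa [zpow_neg_apply_zpow])
  have h2 : (2 : ℤ) ^ n ∣ s - t := dvd_of_zpow_mem_base_of_mem_succ ht
    (by rwa [zpow_apply_zpow, sub_add_cancel])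
  have := dvd_sub h2 h1
  simpa using this

/-- A period is a return time to every `base n`, hence divisible by `2 ^ |s|`, which exceeds `|s|`.
-/
theorem eq_zero_of_zpow_apply_eq {ω : Omega} {s : ℤ} (h : (T ^ s) ω = ω) : s = 0 := by
  by_contra hs
  obtain ⟨t, ht⟩ := exists_zpow_mem_base s.natAbs ω
  have h1 : (T ^ s) ((T ^ t) ω) = (T ^ t) ω := by
    rw [zpow_apply_zpow, add_comm, ← zpow_apply_zpow, h]
  have h2 := dvd_of_zpow_mem_base ht (s := s) (by rwa [h1])
  have h3 := Int.le_of_dvd (by positivity) ((dvd_abs _ _).2 h2)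
  have h4 := Nat.lt_two_pow_self (n := s.natAbs)
  rw [Int.abs_eq_natAbs] at h3
  exact absurd h4 (not_lt.2 (by exact_mod_cast h3))

theorem mem_base_succ_or {n : ℕ} {ω : Omega} (h : ω ∈ base n) :
    ω ∈ base (n + 1) ∨ (T ^ (2 ^ n : ℤ)) ω ∈ base (n + 1) := by
  obtain ⟨t, ht⟩ := exists_zpow_mem_base (n + 1) ω
  obtain ⟨q, rfl⟩ := dvd_of_zpow_mem_base h (base_succ_subset n ht)
  rcases Int.even_or_odd' q with ⟨u, rfl | rfl⟩
  · exact Or.inl ((zpow_mem_base_iff ⟨u, by ring⟩).1 ht)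
  · right
    refine (zpow_mem_base_iff (n := n + 1) (s := 2 ^ n * (2 * u)) ⟨u, by ring⟩).1 ?_
    rw [zpow_apply_zpow]
    convert ht using 3
    ring

theorem apply_zero_ne_a {n : ℕ} {ω : Omega} (h : ω ∈ base (n + 1)) : ω.1 0 ≠ a := by
  have h1 := h 0 n.succ_pos 0
  have h2 := Omega_succ_ne ω 0
  simp only [pow_zero, mul_zero, zero_add, mul_one, level] at h1 h2
  rwa [h1] at h2

theorem apply_zero_of_zpow_mem {n : ℕ} {ω : Omega} (h : (T ^ (2 ^ n : ℤ)) ω ∈ base (n + 1)) :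
    ω.1 0 = level n := by
  have := h n n.lt_succ_self (-1)
  rw [T_zpow_apply] at this
  rw [← this]
  exact congrArg ω.1 (by ring)

theorem zpow_two_pow_notMem {n : ℕ} {ω : Omega} (h : ω ∈ base (n + 1)) :
    (T ^ (2 ^ n : ℤ)) ω ∉ base (n + 1) := by
  intro h'
  have := Int.le_of_dvd (by positivity) (dvd_of_zpow_mem_base h h')
  rw [pow_succ] at this
  have h2 : (0 : ℤ) < 2 ^ n := by positivity
  linarith

theorem isClopen_apply_eq (n : ℤ) (x : Letter) : IsClopen {ω : Omega | ω.1 n = x} :=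
  (isClopen_discrete {x}).preimage ((continuous_apply n).comp continuous_subtype_val)

theorem isClosed_base (n : ℕ) : IsClosed (base n) := by
  have : base n = ⋂ m, ⋂ (_ : m < n), ⋂ u : ℤ, {ω : Omega | ω.1 (2 ^ m * (2 * u + 1)) = level m} := by
    ext ω
    simp [base]
  rw [this]
  exact isClosed_iInter fun m => isClosed_iInter fun _ => isClosed_iInter fun u =>
    (isClopen_apply_eq _ _).1

theorem exists_zpow_mem_base_lt (n : ℕ) (ω : Omega) :
    ∃ r : ℤ, 0 ≤ r ∧ r < 2 ^ n ∧ (T ^ r) ω ∈ base n := by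
  obtain ⟨t, ht⟩ := exists_zpow_mem_base n ω
  refine ⟨t % 2 ^ n, Int.emod_nonneg _ (by positivity), Int.emod_lt_of_pos _ (by positivity), ?_⟩
  refine (zpow_mem_base_iff (s := 2 ^ n * (t / 2 ^ n)) ⟨_, rfl⟩).1 ?_
  rw [zpow_apply_zpow]
  convert ht using 3
  rw [add_comm, Int.emod_add_mul_ediv]

/-- The complement is the union of finitely many translates of the closed set `base n`. -/
theorem isClopen_base (n : ℕ) : IsClopen (base n) := by
  refine ⟨isClosed_base n, ?_⟩
  have : base n = (⋃ r ∈ Set.Ioo (0 : ℤ) (2 ^ n), (T ^ r) ⁻¹' base n)ᶜ := by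
    ext ω
    simp only [Set.mem_compl_iff, Set.mem_iUnion, not_exists, Set.mem_preimage]
    constructor
    · intro h r hr h'
      have := Int.le_of_dvd hr.1 (dvd_of_zpow_mem_base h h')
      exact absurd hr.2 (not_lt.2 this)
    · intro h
      obtain ⟨r, h0, h1, hr⟩ := exists_zpow_mem_base_lt n ω
      rcases h0.eq_or_lt with rfl | h0
      · simpa using hr
      · exact absurd hr (h r ⟨h0, h1⟩)
  rw [this, isOpen_compl_iff]
  exact (Set.finite_Ioo _ _).isClosed_biUnion fun r _ =>
    (isClosed_base n).preimage (T ^ r).continuous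

theorem apply_eq_of_mem_base {n : ℕ} {ω ω' : Omega} (h : ω ∈ base n) (h' : ω' ∈ base n) {i : ℤ}
    (hi : ¬ (2 : ℤ) ^ n ∣ i) : ω.1 i = ω'.1 i := by
  obtain ⟨m, hm, u, rfl⟩ := exists_eq_of_not_dvd n hi
  rw [h m hm, h' m hm]

end Lysenok

/-! ### Induction on the sets `pointed n x` -/

namespace Lysenok

open Letter

/-- The part of `base n` with the letter `x` at the origin. -/
def pointed (n : ℕ) (x : Letter) : Set Omega := base n ∩ {ω | ω.1 0 = x}

theorem isClopen_pointed (n : ℕ) (x : Letter) : IsClopen (pointed n x) :=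
  (isClopen_base n).inter (isClopen_apply_eq 0 x)

theorem disjoint_pointed {n m : ℕ} {x y : Letter} (h : x ≠ y) :
    Disjoint (pointed n x) (pointed m y) :=
  Set.disjoint_left.2 fun _ h1 h2 => h (h1.2.symm.trans h2.2)

/-- A point of `base n` outside `base (n + 1)` carries `level n` at the origin, so for other letters
nothing changes. -/
theorem pointed_succ_of_ne {n : ℕ} {x : Letter} (hx : x ≠ level n) :
    pointed (n + 1) x = pointed n x := by
  ext ω
  refine ⟨fun h => ⟨base_succ_subset n h.1, h.2⟩, fun h => ⟨?_, h.2⟩⟩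
  rcases mem_base_succ_or h.1 with h' | h'
  · exact h'
  · exact absurd (h.2.symm.trans (apply_zero_of_zpow_mem h')) hx

theorem pointed_level (n : ℕ) : pointed n (level n) =
    (T ^ (2 ^ n : ℤ)) ⁻¹' base (n + 1) ∪ pointed (n + 1) (level n) := by
  ext ω
  constructor
  · rintro ⟨h1, h2⟩
    rcases mem_base_succ_or h1 with h' | h'
    · exact Or.inr ⟨h', h2⟩
    · exact Or.inl h'
  · rintro (h | h)
    · exact ⟨(zpow_mem_base_iff dvd_rfl).1 (base_succ_subset n h), apply_zero_of_zpow_mem h⟩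
    · exact ⟨base_succ_subset n h.1, h.2⟩

/-- Three equal letters at distance `2 ^ n` detect `base (n + 1)`; the intersection has the shape
required by `cycleThree_mem`. -/
theorem pointed_succ_level (n : ℕ) : pointed (n + 1) (level n) =
    pointed n (level n) ∩ (T ^ (2 ^ n : ℤ)) ⁻¹' pointed n (level n) ∩
      (T ^ (-2 ^ n : ℤ)) ⁻¹' pointed n (level n) := by
  ext ω
  constructor
  · rintro ⟨h1, h2⟩
    have h3 := base_succ_subset n h1
    refine ⟨⟨⟨h3, h2⟩, zpow_mem_base h3 dvd_rfl, ?_⟩, zpow_mem_base h3 ((dvd_neg).2 dvd_rfl), ?_⟩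
    · have := h1 n n.lt_succ_self 0
      rw [Set.mem_ofPred_eq, T_zpow_apply, ← this]
      exact congrArg ω.1 (by ring)
    · have := h1 n n.lt_succ_self (-1)
      rw [Set.mem_ofPred_eq, T_zpow_apply, ← this]
      exact congrArg ω.1 (by ring)
  · rintro ⟨⟨⟨h1, h2⟩, -, h3⟩, -, h4⟩
    refine ⟨?_, h2⟩
    rw [Set.mem_ofPred_eq, T_zpow_apply, zero_add] at h3 h4
    rcases mem_base_succ_or h1 with h' | h'
    · exact h'
    -- Here the origin is an odd multiple of `2 ^ n`, so one of the neighbours at `±2 ^ n` has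
    -- valuation exactly `n + 1` and carries `level (n + 1)`.
    · exfalso
      rcases mem_base_succ_or h' with h'' | h''
      · have := h'' (n + 1) (by omega) (-1)
        rw [T_zpow_apply] at this
        apply level_ne_succ n
        rw [← this, ← h4]
        exact congrArg ω.1 (by ring)
      · have := h'' (n + 1) (by omega) (-1)
        rw [T_zpow_apply, T_zpow_apply] at this
        apply level_ne_succ n
        rw [← this, ← h3]
        exact congrArg ω.1 (by ring)

theorem base_eq_union {n : ℕ} {x y z : Letter} (h : ∀ l : Letter, l ≠ a → l = x ∨ l = y ∨ l = z) :
    base (n + 1) = pointed (n + 1) x ∪ pointed (n + 1) y ∪ pointed (n + 1) z := by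
  ext ω
  constructor
  · intro hω
    rcases h _ (apply_zero_ne_a hω) with h | h | h
    · exact Or.inl (Or.inl ⟨hω, h⟩)
    · exact Or.inl (Or.inr ⟨hω, h⟩)
    · exact Or.inr ⟨hω, h⟩
  · rintro ((h | h) | h) <;> exact h.1

theorem T_mem_base_false {n : ℕ} {ω : Omega} (h : ω ∈ base (n + 1)) : T ω ∉ base (n + 1) := by
  intro h'
  have h1 := dvd_of_zpow_mem_base h (s := 1) (by simpa using h')
  have h2 := (pow_dvd_pow (2 : ℤ) (show 1 ≤ n + 1 by omega)).trans h1
  norm_num at h2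

theorem disjoint_base (n : ℕ) : Disjoint (base (n + 1)) (T '' base (n + 1)) :=
  disjoint_image_iff.2 fun _ h => T_mem_base_false h

theorem disjoint_image_pointed (n : ℕ) (x : Letter) :
    Disjoint (pointed (n + 1) x) (T '' pointed (n + 1) x) :=
  disjoint_image_mono Set.inter_subset_left (disjoint_base n)

/-- Return times are multiples of 4. At level 1 they would include 2, which is why the induction
starts at level 2. -/
theorem threeLevels_base (n : ℕ) : ThreeLevels T (base (n + 2)) := by
  intro ω h
  refine ⟨T_mem_base_false h, fun h' => ?_⟩
  have h1 := dvd_of_zpow_mem_base h (s := 2)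
    (by rw [zpow_two]; exact h')
  have h2 := (pow_dvd_pow (2 : ℤ) (show 2 ≤ n + 2 by omega)).trans h1
  norm_num at h2

theorem preimage_zpow_pointed_subset (n : ℕ) (x : Letter) {s : ℤ} (hs : (2 : ℤ) ^ n ∣ s) :
    (T ^ s) ⁻¹' pointed n x ⊆ base n :=
  fun _ h => (zpow_mem_base_iff hs).1 h.1

theorem cycleThree_pointed_mem {H : Subgroup (Omega ≃ₜ Omega)} (hT : T ∈ H) (n : ℕ)
    (h : DeltaMem T H (pointed (n + 2) (level (n + 2)))) :
    cycleThree T (pointed (n + 3) (level (n + 2))) (isClopen_pointed _ _)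
      (disjoint_image_pointed _ _) ∈ H := by
  have e := pointed_succ_level (n + 2)
  have h1 := cycleThree_mem hT (V := pointed (n + 2) (level (n + 2))) (threeLevels_base n) Set.inter_subset_left
    (preimage_zpow_pointed_subset _ _ dvd_rfl)
    (preimage_zpow_pointed_subset _ _ ((dvd_neg).2 dvd_rfl)) h (h.zpow_preimage hT (2 ^ (n + 2)))
    (h.zpow_preimage hT (-2 ^ (n + 2)))
    (by rw [← e]; exact isClopen_pointed _ _) (by rw [← e]; exact disjoint_image_pointed _ _)
  simpa only [← e] using h1

/-- Let `x`, `y`, `z` be the letters of levels `n + 2`, `n + 3`, `n + 4`; only `x` gives a new set.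
With `P = pointed (n + 4) y` and `N = 2 ^ (n + 3)`, the known set `pointed (n + 3) y` is the
disjoint union of `P` and the `T ^ N`-preimages of `P`, `pointed (n + 4) z` and `pointed (n + 4) x`.
The first two are handled together by the 3-cycle over `P`, the third is a translate of a known set,
so the last follows by cancellation. -/
theorem deltaMem_pointed_succ {H : Subgroup (Omega ≃ₜ Omega)} (hT : T ∈ H) (n : ℕ)
    (h : ∀ x ≠ a, DeltaMem T H (pointed (n + 2) x)) :
    ∀ x ≠ a, DeltaMem T H (pointed (n + 3) x) := by
  intro x hx
  by_cases hxl : x ≠ level (n + 2)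
  · rw [pointed_succ_of_ne hxl]
    exact h x hx
  push Not at hxl
  obtain ⟨y, hy⟩ : ∃ y, y = level (n + 3) := ⟨_, rfl⟩
  obtain ⟨z, hz⟩ : ∃ z, z = level (n + 4) := ⟨_, rfl⟩
  have hcases := level_cases (n + 1)
  rw [show n + 1 + 1 = n + 2 from rfl, show n + 1 + 2 = n + 3 from rfl,
    show n + 1 + 3 = n + 4 from rfl, ← hxl, ← hy, ← hz] at hcases
  have hall : ∀ l : Letter, l ≠ a → l = x ∨ l = y ∨ l = z := by
    intro l hl
    rw [hxl, hy, hz]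
    exact eq_level_of_ne_a (n + 1) hl
  have hxy : x ≠ y := by rcases hcases with ⟨rfl, rfl, -⟩ | ⟨rfl, rfl, -⟩ | ⟨rfl, rfl, -⟩ <;> simp
  have hyz : y ≠ z := by rcases hcases with ⟨-, rfl, rfl⟩ | ⟨-, rfl, rfl⟩ | ⟨-, rfl, rfl⟩ <;> simp
  have hxz : x ≠ z := by
    rcases hcases with ⟨rfl, -, rfl⟩ | ⟨rfl, -, rfl⟩ | ⟨rfl, -, rfl⟩ <;> simp
  have hya : y ≠ a := hy ▸ level_succ_ne_a (n + 2)
  have hza : z ≠ a := hz ▸ level_succ_ne_a (n + 3)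
  have hY : DeltaMem T H (pointed (n + 3) y) := by
    rw [pointed_succ_of_ne (hxl ▸ hxy.symm)]
    exact h y hya
  have hZ : DeltaMem T H (pointed (n + 4) z) := by
    rw [pointed_succ_of_ne (hy ▸ hyz.symm), pointed_succ_of_ne (hxl ▸ hxz.symm)]
    exact h z hza
  have hC : cycleThree T (pointed (n + 4) y) (isClopen_pointed _ _)
      (disjoint_image_pointed _ _) ∈ H := by
    have := cycleThree_pointed_mem hT (n + 1) (by rw [show n + 1 + 2 = n + 3 from rfl, ← hy]; exact hY)
    simpa only [show n + 1 + 2 = n + 3 from rfl, ← hy] using this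
  -- The number of telescoping steps is the shift in `pointed_level (n + 3)`, which puts both `P`
  -- and its translate inside `pointed (n + 3) y`.
  have hP := delta_mul_delta_mem hT _ _ hC (2 ^ (n + 3))
  rw [show pointed (n + 3) x = pointed (n + 4) x from
    (pointed_succ_of_ne (hy ▸ hxy)).symm]
  set N : ℤ := 2 ^ (n + 3) with hN
  have hN' : ((2 ^ (n + 3) : ℕ) : ℤ) = N := by push_cast; rfl
  simp only [hN'] at hP
  have hlev : pointed (n + 3) y = (T ^ N) ⁻¹' base (n + 4) ∪ pointed (n + 4) y := by
    rw [hy]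
    exact pointed_level (n + 3)
  have hYd : Disjoint (pointed (n + 4) y) ((T ^ N) ⁻¹' base (n + 4)) :=
    Set.disjoint_left.2 fun ω h1 h2 => zpow_two_pow_notMem h1.1 h2
  have hd := disjoint_image_pointed (n + 2) y
  have hsub : ∀ l, (T ^ N) ⁻¹' pointed (n + 4) l ⊆ (T ^ N) ⁻¹' base (n + 4) := fun l =>
    Set.preimage_mono Set.inter_subset_left
  have hYY : DeltaMem T H (pointed (n + 4) y ∪ (T ^ N) ⁻¹' pointed (n + 4) y) := by
    refine ⟨(isClopen_pointed _ _).union (isClopen_zpow_preimage (isClopen_pointed _ _) _),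
      disjoint_image_mono ?_ hd, ?_⟩
    · rw [hlev]
      exact Set.union_subset Set.subset_union_right ((hsub y).trans Set.subset_union_left)
    · rw [delta_union (isClopen_pointed _ _) (disjoint_image_pointed _ _)
        (isClopen_zpow_preimage (isClopen_pointed _ _) _)
        (disjoint_zpow_preimage (disjoint_image_pointed _ _) _) (hYd.mono_right (hsub y))]
      exact hP
  have heq : pointed (n + 3) y = (T ^ N) ⁻¹' pointed (n + 4) z ∪
      (pointed (n + 4) y ∪ (T ^ N) ⁻¹' pointed (n + 4) y) ∪ (T ^ N) ⁻¹' pointed (n + 4) x := by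
    rw [hlev, base_eq_union hall, Set.preimage_union, Set.preimage_union]
    ext ω
    simp only [Set.mem_union]
    tauto
  have hdz : Disjoint ((T ^ N) ⁻¹' pointed (n + 4) z)
      (pointed (n + 4) y ∪ (T ^ N) ⁻¹' pointed (n + 4) y) :=
    Set.disjoint_union_right.2 ⟨(hYd.mono_right (hsub z)).symm,
      (disjoint_pointed hyz.symm).preimage _⟩
  have hdx : Disjoint ((T ^ N) ⁻¹' pointed (n + 4) z ∪
      (pointed (n + 4) y ∪ (T ^ N) ⁻¹' pointed (n + 4) y)) ((T ^ N) ⁻¹' pointed (n + 4) x) :=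
    Set.disjoint_union_left.2 ⟨(disjoint_pointed hxz.symm).preimage _,
      Set.disjoint_union_left.2 ⟨hYd.mono_right (hsub x), (disjoint_pointed hxy.symm).preimage _⟩⟩
  refine DeltaMem.of_zpow_preimage hT N (DeltaMem.of_union ?_
    (isClopen_zpow_preimage (isClopen_pointed _ _) _) hdx (heq ▸ hY))
  refine (hZ.zpow_preimage hT N).union hYY hdz (disjoint_image_mono ?_ hd)
  rw [heq]
  exact Set.subset_union_left

/-! ### The generating cylinders as translates of pointed sets -/

theorem base_one_apply {n : ℤ} {ω : Omega} (h : (T ^ n) ω ∈ base 1) (u : ℤ) :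
    ω.1 (n + 2 * u + 1) = a := by
  have := h 0 one_pos u
  rw [T_zpow_apply] at this
  exact (congrArg ω.1 (by ring)).trans this

theorem mem_base_one_iff {ω : Omega} {n : ℤ} : (T ^ n) ω ∈ base 1 ↔ ω.1 n ≠ a := by
  constructor
  · intro h
    have := apply_zero_ne_a h
    rwa [T_zpow_apply, zero_add] at this
  · intro h
    obtain ⟨r, hr⟩ := exists_zpow_mem_base 1 ω
    have : (2 : ℤ) ^ 1 ∣ n - r := by
      rcases Int.even_or_odd' (n - r) with ⟨u, hu | hu⟩
      · exact ⟨u, by rw [hu]; ring⟩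
      · exact absurd ((congrArg ω.1 (by linarith)).trans (base_one_apply hr u)) h
    have h2 := zpow_mem_base hr this
    rwa [zpow_apply_zpow, sub_add_cancel] at h2

theorem mem_pointed_one_iff {ω : Omega} {n : ℤ} {x : Letter} (hx : x ≠ a) :
    (T ^ n) ω ∈ pointed 1 x ↔ ω.1 n = x := by
  rw [pointed, Set.mem_inter_iff, mem_base_one_iff, Set.mem_ofPred_eq, T_zpow_apply, zero_add]
  exact ⟨fun h => h.2, fun h => ⟨h ▸ hx, h⟩⟩

theorem cylinder_singleton {x : Letter} (hx : x ≠ a) :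
    cylinder [] [x] = (T ^ (1 : ℤ)) ⁻¹' pointed 1 x := by
  ext ω
  rw [Set.mem_preimage, mem_pointed_one_iff hx]
  simp [cylinder]

theorem apply_eq_a_of_succ {ω : Omega} {n : ℤ} (h : ω.1 (n + 1) ≠ a) : ω.1 n = a := by
  have := base_one_apply (mem_base_one_iff.2 h) (-1)
  exact (congrArg ω.1 (by ring)).trans this

/-- Cylinders start at coordinate 1, so the three `c`'s are at 2, 4, 6 and the middle one at 4 is
the centre in `pointed_succ_level 1`. The `a`'s are forced by alternation. -/
theorem cylinder_acacac :
    cylinder [] [a, c, a, c, a, c] = (T ^ (4 : ℤ)) ⁻¹' pointed 2 c := by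
  ext ω
  have e : pointed 2 c = pointed 1 c ∩ (T ^ (2 : ℤ)) ⁻¹' pointed 1 c ∩
    (T ^ (-2 : ℤ)) ⁻¹' pointed 1 c := pointed_succ_level 1
  have hc : c ≠ a := by simp
  rw [Set.mem_preimage, e, Set.mem_inter_iff, Set.mem_inter_iff, Set.mem_preimage, Set.mem_preimage,
    zpow_apply_zpow, zpow_apply_zpow, mem_pointed_one_iff hc, mem_pointed_one_iff hc,
    mem_pointed_one_iff hc]
  norm_num
  simp only [cylinder, Set.mem_ofPred_eq]
  constructor
  · rintro ⟨-, h⟩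
    exact ⟨⟨h ⟨3, by simp⟩, h ⟨5, by simp⟩⟩, h ⟨1, by simp⟩⟩
  · rintro ⟨⟨h4, h6⟩, h2⟩
    have h1 : ω.1 1 = a := apply_eq_a_of_succ (by norm_num [h2, hc])
    have h3 : ω.1 3 = a := apply_eq_a_of_succ (by norm_num [h4, hc])
    have h5 : ω.1 5 = a := apply_eq_a_of_succ (by norm_num [h6, hc])
    refine ⟨fun i => i.elim0, fun i => ?_⟩
    fin_cases i
    · exact h1
    · exact h2
    · exact h3
    · exact h4
    · exact h5
    · exact h6

theorem deltaMem_of_deltaCylinder {H : Subgroup (Omega ≃ₜ Omega)} {u w : List Letter}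
    {h : u ≠ [] ∨ w ≠ []} (hH : deltaCylinder u w h ∈ H) : DeltaMem T H (cylinder u w) :=
  ⟨_, _, hH⟩

theorem deltaMem_pointed {H : Subgroup (Omega ≃ₜ Omega)} (hT : T ∈ H)
    (hb : DeltaMem T H (cylinder [] [b])) (hd : DeltaMem T H (cylinder [] [d]))
    (hc : DeltaMem T H (cylinder [] [a, c, a, c, a, c])) (n : ℕ) :
    ∀ x ≠ a, DeltaMem T H (pointed (n + 2) x) := by
  induction n with
  | zero =>
    rw [cylinder_singleton (by simp)] at hb hd
    rw [cylinder_acacac] at hc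
    intro x hx
    cases x with
    -- Since `level 1 = c`, for `b` and `d` the sets `pointed 2` and `pointed 1` agree.
    | a => exact absurd rfl hx
    | b => rw [pointed_succ_of_ne (by simp [level])]; exact hb.of_zpow_preimage hT
    | c => exact hc.of_zpow_preimage hT
    | d => rw [pointed_succ_of_ne (by simp [level])]; exact hd.of_zpow_preimage hT
  | succ n ih => exact deltaMem_pointed_succ hT n ih

/-! ### Compactness, and `δ_U` for arbitrary clopen sets -/

instance : Finite Letter :=
  Finite.of_injective (β := Fin 4)
    (fun x => match x with | a => 0 | b => 1 | c => 2 | d => 3)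
    (by intro x y; cases x <;> cases y <;> simp)

theorem isClosed_Omega : IsClosed Omega := by
  have : Omega = ⋂ l : ℤ, ⋂ n : ℕ, (fun (ω : ℤ → Letter) (i : Fin n) => ω (l + (i : ℕ))) ⁻¹'
      {v | ∃ k : ℕ, ∀ i : Fin n, v i = xi (k + i)} := by
    ext ω
    simp only [Omega, Set.mem_ofPred_eq, Set.mem_iInter, Set.mem_preimage]
    exact forall_congr' fun l => forall_congr' fun n => exists_congr fun k =>
      ⟨fun h i => h i i.2, fun h i hi => h ⟨i, hi⟩⟩
  rw [this]
  exact isClosed_iInter fun l => isClosed_iInter fun n =>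
    (isClosed_discrete _).preimage (by fun_prop)

instance : CompactSpace Omega := isCompact_iff_compactSpace.1 isClosed_Omega.isCompact

/-- A continuous function with discrete values depends on a finite window only. -/
theorem exists_window {α : Type*} [TopologicalSpace α] [DiscreteTopology α] {f : Omega → α}
    (hf : Continuous f) : ∃ R : ℕ, ∀ ω ω' : Omega, (∀ i : ℤ, |i| ≤ R → ω.1 i = ω'.1 i) →
      f ω = f ω' := by
  by_contra! hcon
  -- These compact sets decrease with `R`; a common point would be a pair of equal sequences with
  -- different values of `f`.
  let K (R : ℕ) : Set (Omega × Omega) :=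
    {p | (∀ i : ℤ, |i| ≤ R → p.1.1 i = p.2.1 i) ∧ f p.1 ≠ f p.2}
  have hK : ∀ R, IsClosed (K R) := by
    intro R
    have h1 : IsClosed {p : Omega × Omega | ∀ i : ℤ, |i| ≤ R → p.1.1 i = p.2.1 i} := by
      simp only [Set.ofPred_forall]
      exact isClosed_iInter fun i => isClosed_iInter fun _ =>
        isClosed_eq
          ((continuous_apply i).comp (continuous_subtype_val.comp continuous_fst))
          ((continuous_apply i).comp (continuous_subtype_val.comp continuous_snd))
    have h2 : IsClosed {p : Omega × Omega | f p.1 ≠ f p.2} :=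
      (isClosed_discrete {q : α × α | q.1 ≠ q.2}).preimage
        ((hf.comp continuous_fst).prodMk (hf.comp continuous_snd))
    exact h1.inter h2
  obtain ⟨p, hp⟩ := IsCompact.nonempty_iInter_of_sequence_nonempty_isCompact_isClosed K
    (fun R p hp => ⟨fun i hi => hp.1 i (hi.trans (by push_cast; linarith)), hp.2⟩)
    (fun R => by
      obtain ⟨ω, ω', h1, h2⟩ := hcon R
      exact ⟨(ω, ω'), h1, h2⟩)
    (hK 0).isCompact hK
  rw [Set.mem_iInter] at hp
  refine (hp 0).2 (congrArg f (Subtype.ext (funext fun i => ?_)))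
  exact (hp i.natAbs).1 i (by rw [Int.abs_eq_natAbs])

theorem eq_zero_of_two_pow_dvd {n : ℕ} {s : ℤ} (h : (2 : ℤ) ^ n ∣ s) (h' : |s| < 2 ^ n) : s = 0 :=
  Int.eq_zero_of_abs_lt_dvd h h'

theorem deltaMem_of_isClopen {H : Subgroup (Omega ≃ₜ Omega)} (hT : T ∈ H)
    (h : ∀ n, ∀ x ≠ a, DeltaMem T H (pointed (n + 2) x)) {V : Set Omega} (hV : IsClopen V)
    (hd : Disjoint V (T '' V)) : DeltaMem T H V := by
  obtain ⟨R, hR⟩ := exists_window ((continuous_boolIndicator_iff_isClopen V).2 hV)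
  have hR' : ∀ ω ω' : Omega, (∀ i : ℤ, |i| ≤ R → ω.1 i = ω'.1 i) → (ω ∈ V ↔ ω' ∈ V) := by
    intro ω ω' h
    rw [Set.mem_iff_boolIndicator, Set.mem_iff_boolIndicator, hR ω ω' h]
  obtain ⟨m, hm⟩ : ∃ m : ℕ, (R : ℤ) < 2 ^ (m + 1) :=
    ⟨R, by exact_mod_cast (Nat.lt_two_pow_self).trans (Nat.pow_lt_pow_right (by norm_num) R.lt_succ_self)⟩
  have h2 : (2 : ℤ) ^ (m + 2) = 2 ^ (m + 1) + 2 ^ (m + 1) := by ring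
  let atom (s : ℤ × Letter) : Set Omega := (T ^ s.1) ⁻¹' pointed (m + 2) s.2
  -- The offsets form a complete residue system modulo `2 ^ (m + 2)`, so the atoms partition `Ω`. On
  -- an atom with offset `s`, the only coordinate of the window that `base` may leave free is `s`
  -- itself, and its letter is fixed by the atom.
  let I : Finset (ℤ × Letter) := Finset.Ico (-2 ^ (m + 1)) (2 ^ (m + 1)) ×ˢ {b, c, d}
  have key : ∀ S : Finset (ℤ × Letter), S ⊆ I → DeltaMem T H (V ∩ ⋃ s ∈ S, atom s) := by
    intro S
    induction S using Finset.induction_on with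
    | empty =>
      intro _
      simpa using DeltaMem.empty T H
    | insert s S hs ih =>
      intro hI
      have hsI : s ∈ I := hI (Finset.mem_insert_self s S)
      have hSI : S ⊆ I := (Finset.subset_insert s S).trans hI
      have hs1 := Finset.mem_Ico.1 (Finset.mem_product.1 hsI).1
      have hsa : s.2 ≠ a := by
        have := (Finset.mem_product.1 hsI).2
        rintro h
        simp [h] at this
      have e : V ∩ ⋃ t ∈ insert s S, atom t = (V ∩ atom s) ∪ (V ∩ ⋃ t ∈ S, atom t) := by
        rw [Finset.set_biUnion_insert, Set.inter_union_distrib_left]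
      rw [e]
      refine DeltaMem.union ?_ (ih hSI) ?_ (disjoint_image_mono (e ▸ Set.inter_subset_left) hd)
      · by_cases hne : (V ∩ atom s).Nonempty
        · obtain ⟨ω, hω, hωs⟩ := hne
          have : V ∩ atom s = atom s := by
            refine Set.inter_eq_right.2 fun ω' hω' => (hR' ω ω' fun i hi => ?_).1 hω
            have e1 : ∀ ω : Omega, ω.1 i = ((T ^ s.1) ω).1 (i - s.1) := fun ω => by
              rw [T_zpow_apply, sub_add_cancel]
            rw [e1, e1]
            by_cases h0 : i - s.1 = 0
            · rw [h0, hωs.2, hω'.2]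
            · refine apply_eq_of_mem_base hωs.1 hω'.1 fun hdvd => h0 (eq_zero_of_two_pow_dvd hdvd ?_)
              have := abs_le.1 hi
              rw [abs_lt]
              constructor <;> linarith
          rw [this]
          exact (h m s.2 hsa).zpow_preimage hT s.1
        · rw [Set.not_nonempty_iff_eq_empty.1 hne]
          exact DeltaMem.empty T H
      · rw [Set.disjoint_left]
        rintro ω ⟨-, h1⟩ ⟨-, h2'⟩
        simp only [Set.mem_iUnion] at h2'
        obtain ⟨t, ht, h3⟩ := h2'
        have ht1 := Finset.mem_Ico.1 (Finset.mem_product.1 (hSI ht)).1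
        have h4 : (2 : ℤ) ^ (m + 2) ∣ t.1 - s.1 := by
          refine dvd_of_zpow_mem_base h1.1 ?_
          rw [zpow_apply_zpow, sub_add_cancel]
          exact h3.1
        have h5 := eq_zero_of_two_pow_dvd h4 (by rw [abs_lt]; constructor <;> linarith)
        have h6 : s.1 = t.1 := by linarith
        have h7 : s.2 = t.2 := by
          rw [← h1.2, ← h3.2, h6]
        exact hs (Prod.ext h6 h7 ▸ ht)
  have hfull : V ∩ ⋃ s ∈ I, atom s = V := by
    refine Set.inter_eq_left.2 fun ω _ => ?_
    obtain ⟨r, hr0, hr1, hr⟩ := exists_zpow_mem_base_lt (m + 2) ((T ^ (-2 ^ (m + 1) : ℤ)) ω)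
    rw [zpow_apply_zpow] at hr
    have hx := apply_zero_ne_a hr
    rw [Set.mem_iUnion₂]
    refine ⟨(r + -2 ^ (m + 1), ((T ^ (r + -2 ^ (m + 1))) ω).1 0), ?_, hr, rfl⟩
    rw [Finset.mem_product, Finset.mem_Ico]
    refine ⟨⟨by linarith, by linarith⟩, ?_⟩
    generalize ((T ^ (r + -2 ^ (m + 1))) ω).1 0 = y at hx
    cases y <;> simp at hx ⊢
  have := key I subset_rfl
  rwa [hfull] at this

end Lysenok

/-! ### Towers and the decomposition of elements of the full group -/

section Towers

variable {X : Type*} [TopologicalSpace X]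

/-- The sets `M, T(M), …, T^(N-1)(M)` form a clopen partition of the space and `T^N(M) = M`. -/
structure IsTower (T : X ≃ₜ X) (M : Set X) (N : ℕ) : Prop where
  isClopen : IsClopen M
  exists_mem : ∀ x, ∃ m ∈ M, ∃ i : Fin N, x = (T ^ (i : ℤ)) m
  zpow_mem_iff : ∀ x ∈ M, ∀ s : ℤ, (T ^ s) x ∈ M ↔ (N : ℤ) ∣ s

theorem IsTower.eq_zero {T : X ≃ₜ X} {M : Set X} {N : ℕ} (hM : IsTower T M N) {x : X} (hx : x ∈ M)
    {s : ℤ} (h : (T ^ s) x ∈ M) (hs : |s| < N) : s = 0 :=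
  Int.eq_zero_of_abs_lt_dvd ((hM.zpow_mem_iff x hx s).1 h) hs

theorem IsTower.preimage {T : X ≃ₜ X} {M : Set X} {N : ℕ} (hM : IsTower T M N) (j : ℤ) :
    IsTower T ((T ^ j) ⁻¹' M) N where
  isClopen := isClopen_zpow_preimage hM.isClopen j
  exists_mem x := by
    obtain ⟨m, hm, i, hi⟩ := hM.exists_mem ((T ^ j) x)
    refine ⟨(T ^ (-j)) m, ?_, i, ?_⟩
    · rw [Set.mem_preimage, zpow_apply_zpow]
      simpa using hm
    · rw [zpow_apply_zpow, add_comm, ← zpow_apply_zpow, ← hi, zpow_neg_apply_zpow]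
  zpow_mem_iff x hx s := by
    rw [Set.mem_preimage, zpow_apply_zpow, add_comm, ← zpow_apply_zpow]
    exact hM.zpow_mem_iff _ hx s

/-- A permutation of the levels of a tower over a clopen part of its base is a product of
transformations `δ_U`. -/
theorem IsTower.exists_perm {T : X ≃ₜ X} {H : Subgroup (X ≃ₜ X)}
    (hH : ∀ U : Set X, IsClopen U → Disjoint U (T '' U) → DeltaMem T H U) {M : Set X} {n : ℕ}
    (hM : IsTower T M (n + 1)) {V : Set X} (hV : IsClopen V) (hVM : V ⊆ M)
    (π : Equiv.Perm (Fin (n + 1))) :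
    ∃ h ∈ H, (∀ m ∈ V, ∀ i : Fin (n + 1), h ((T ^ (i : ℤ)) m) = (T ^ (π i : ℤ)) m) ∧
      ∀ m ∈ M, m ∉ V → ∀ i : Fin (n + 1), h ((T ^ (i : ℤ)) m) = (T ^ (i : ℤ)) m := by
  have hπ : π ∈ Submonoid.closure (Set.range fun i : Fin n => Equiv.swap i.castSucc i.succ) := by
    rw [Equiv.Perm.mclosure_swap_castSucc_succ]
    trivial
  induction hπ using Submonoid.closure_induction with
  | one => exact ⟨1, H.one_mem, fun _ _ _ => rfl, fun _ _ _ _ => rfl⟩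
  | mul π₁ π₂ _ _ ih₁ ih₂ =>
    obtain ⟨h₁, hm₁, h₁', h₁''⟩ := ih₁
    obtain ⟨h₂, hm₂, h₂', h₂''⟩ := ih₂
    refine ⟨h₁ * h₂, H.mul_mem hm₁ hm₂, fun m hm i => ?_, fun m hm hm' i => ?_⟩
    · rw [Homeomorph.mul_apply, h₂' m hm, h₁' m hm, Equiv.Perm.mul_apply]
    · rw [Homeomorph.mul_apply, h₂'' m hm hm', h₁'' m hm hm']
  | mem π hπ =>
    obtain ⟨k, rfl⟩ := hπ
    have hk := k.2
    -- Swapping levels `k` and `k + 1` over `V` is `δ` of the set `T ^ k (V)`.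
    have hU : IsClopen ((T ^ (-(k : ℤ))) ⁻¹' V) := isClopen_zpow_preimage hV _
    have hd : Disjoint ((T ^ (-(k : ℤ))) ⁻¹' V) (T '' ((T ^ (-(k : ℤ))) ⁻¹' V)) := by
      refine disjoint_zpow_preimage (disjoint_image_iff.2 fun x hx hx' => ?_) _
      have := hM.eq_zero (hVM hx) (s := 1) (by simpa using hVM hx') (by push_cast; norm_num; omega)
      omega
    obtain ⟨_, _, hδ⟩ := hH _ hU hd
    have e1 : ∀ (m : X) (i : ℤ), (T ^ i) m ∈ (T ^ (-(k : ℤ))) ⁻¹' V ↔ (T ^ (i - k)) m ∈ V := by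
      intro m i
      rw [Set.mem_preimage, zpow_apply_zpow, neg_add_eq_sub]
    have e2 : ∀ (m : X) (i : ℤ), T.symm ((T ^ i) m) = (T ^ (i - 1)) m := by
      intro m i
      rw [← zpow_neg_one_apply, zpow_apply_zpow, neg_add_eq_sub]
    have e3 : ∀ m ∈ M, ∀ i : ℤ, |i| < (n + 1 : ℕ) → ((T ^ i) m ∈ V ↔ i = 0 ∧ m ∈ V) := by
      intro m hm i hi
      constructor
      · intro h
        have := hM.eq_zero hm (hVM h) hi
        subst this
        exact ⟨rfl, by simpa using h⟩
      · rintro ⟨rfl, h⟩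
        simpa using h
    have e4 : ∀ m ∈ M, ∀ i : Fin (n + 1), ((T ^ (i : ℤ)) m ∈ (T ^ (-(k : ℤ))) ⁻¹' V ↔
        (i : ℤ) - k = 0 ∧ m ∈ V) := by
      intro m hm i
      rw [e1, e3 m hm _ (by rw [abs_lt]; omega)]
    have e5 : ∀ m ∈ M, ∀ i : Fin (n + 1), (T.symm ((T ^ (i : ℤ)) m) ∈ (T ^ (-(k : ℤ))) ⁻¹' V ↔
        (i : ℤ) - 1 - k = 0 ∧ m ∈ V) := by
      intro m hm i
      rw [e2, e1, e3 m hm _ (by rw [abs_lt]; omega)]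
    refine ⟨_, hδ, fun m hm i => ?_, fun m hm hm' i => ?_⟩
    · rw [delta_apply]
      simp only [e4 m (hVM hm), e5 m (hVM hm), hm, and_true]
      by_cases h1 : (i : ℤ) - k = 0
      · have : i = k.castSucc := Fin.ext (by rw [Fin.val_castSucc]; omega)
        subst this
        rw [if_pos h1, Equiv.swap_apply_left, ← commute_zpow_apply, ← Homeomorph.mul_apply,
          ← zpow_add_one, Fin.val_succ, Fin.val_castSucc]
        rfl
      · rw [if_neg h1]
        by_cases h2 : (i : ℤ) - 1 - k = 0
        · have : i = k.succ := Fin.ext (by rw [Fin.val_succ]; omega)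
          subst this
          rw [if_pos h2, Equiv.swap_apply_right, e2, Fin.val_castSucc]
          congr 2
          omega
        · rw [if_neg h2, Equiv.swap_apply_of_ne_of_ne]
          · rintro rfl
            rw [Fin.val_castSucc] at h1
            omega
          · rintro rfl
            rw [Fin.val_succ] at h2
            omega
    · rw [delta_apply]
      simp only [e4 m hm, e5 m hm, hm', and_false, if_false]

theorem IsTower.zpow_inj {T : X ≃ₜ X} {M : Set X} {N : ℕ} (hM : IsTower T M N) {x : X}
    (hx : x ∈ M) {i j : Fin N} (h : (T ^ (i : ℤ)) x = (T ^ (j : ℤ)) x) : i = j := by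
  have h1 : (T ^ ((i : ℤ) - j)) x = x := by
    rw [sub_eq_neg_add, ← zpow_apply_zpow, h, zpow_neg_apply_zpow]
  have := hM.eq_zero hx (by rw [h1]; exact hx) (by rw [abs_lt]; omega)
  exact Fin.ext (by omega)

/-- A homeomorphism which permutes the levels in each column of a tower is a product of
transformations `δ_U`. -/
theorem IsTower.mem_of_preserves [T2Space X] {T : X ≃ₜ X} {H : Subgroup (X ≃ₜ X)}
    (hH : ∀ U : Set X, IsClopen U → Disjoint U (T '' U) → DeltaMem T H U) {M : Set X} {n : ℕ}
    (hM : IsTower T M (n + 1)) (g : X ≃ₜ X)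
    (hg : ∀ m ∈ M, ∀ i : Fin (n + 1), ∃ j : Fin (n + 1), g ((T ^ (i : ℤ)) m) = (T ^ (j : ℤ)) m) :
    g ∈ H := by
  -- Induction on the set of permutations that occur on columns: composing with `π⁻¹` over the
  -- columns where `π` occurs removes `π` from the set.
  have main : ∀ (S : Finset (Equiv.Perm (Fin (n + 1)))) (g : X ≃ₜ X),
      (∀ m ∈ M, (∀ i : Fin (n + 1), g ((T ^ (i : ℤ)) m) = (T ^ (i : ℤ)) m) ∨
        ∃ π ∈ S, ∀ i : Fin (n + 1), g ((T ^ (i : ℤ)) m) = (T ^ (π i : ℤ)) m) → g ∈ H := by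
    intro S
    induction S using Finset.induction_on with
    | empty =>
      intro g hg
      have : g = 1 := by
        ext x
        obtain ⟨m, hm, i, rfl⟩ := hM.exists_mem x
        rcases hg m hm with h | ⟨_, h, _⟩
        · exact h i
        · simp at h
      rw [this]
      exact H.one_mem
    | insert π S _ ih =>
      intro g hg
      let V (ρ : Equiv.Perm (Fin (n + 1))) : Set X :=
        {m | m ∈ M ∧ ∀ i : Fin (n + 1), g ((T ^ (i : ℤ)) m) = (T ^ (ρ i : ℤ)) m}
      have hclosed : ∀ ρ, IsClosed (V ρ) := by
        intro ρ
        have : V ρ = M ∩ ⋂ i : Fin (n + 1), {m | g ((T ^ (i : ℤ)) m) = (T ^ (ρ i : ℤ)) m} := by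
          ext m
          simp [V]
        rw [this]
        exact hM.isClopen.1.inter (isClosed_iInter fun i =>
          isClosed_eq (g.continuous.comp (T ^ (i : ℤ)).continuous) (T ^ (ρ i : ℤ)).continuous)
      have hcover : ∀ m ∈ M, ∃ ρ, m ∈ V ρ := by
        intro m hm
        rcases hg m hm with h | ⟨ρ, -, h⟩
        · exact ⟨1, hm, h⟩
        · exact ⟨ρ, hm, h⟩
      have hclopen : IsClopen (V π) := by
        refine ⟨hclosed π, ?_⟩
        -- The sets `V ρ` split `M` into finitely many disjoint closed pieces, so each piece is also
        -- open.
        have : V π = M ∩ (⋃ ρ ∈ {ρ | ρ ≠ π}, V ρ)ᶜ := by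
          ext m
          simp only [Set.mem_inter_iff, Set.mem_compl_iff, Set.mem_iUnion, not_exists]
          constructor
          · rintro ⟨hm, h⟩
            refine ⟨hm, fun ρ hρ h' => hρ (Equiv.ext fun i => ?_)⟩
            exact hM.zpow_inj hm ((h'.2 i).symm.trans (h i))
          · rintro ⟨hm, h⟩
            obtain ⟨ρ, hρ⟩ := hcover m hm
            by_cases e : ρ = π
            · exact e ▸ hρ
            · exact absurd hρ (h ρ e)
        rw [this]
        exact hM.isClopen.2.inter
          ((Set.toFinite _).isClosed_biUnion fun ρ _ => hclosed ρ).isOpen_compl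
      obtain ⟨h, hhH, h1, h2⟩ := hM.exists_perm hH hclopen (fun _ h => h.1) π⁻¹
      have : g * h ∈ H := by
        apply ih
        intro m hm
        by_cases hmV : m ∈ V π
        · left
          intro i
          rw [Homeomorph.mul_apply, h1 m hmV, hmV.2]
          simp
        · rcases hg m hm with h' | ⟨ρ, hρ, h'⟩
          · left
            intro i
            rw [Homeomorph.mul_apply, h2 m hm hmV, h']
          · right
            refine ⟨ρ, ?_, fun i => ?_⟩
            · rcases Finset.mem_insert.1 hρ with rfl | hρ
              · exact absurd ⟨hm, h'⟩ hmV
              · exact hρ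
            · rw [Homeomorph.mul_apply, h2 m hm hmV, h']
      exact (H.mul_mem_cancel_right hhH).1 this
  refine main Finset.univ g fun m hm => Or.inr ?_
  choose θ hθ using hg m hm
  have hinj : Function.Injective θ := by
    intro i j hij
    refine hM.zpow_inj hm (g.injective ?_)
    rw [hθ, hθ, hij]
  exact ⟨Equiv.ofBijective θ (Finite.injective_iff_bijective.1 hinj), Finset.mem_univ _, hθ⟩

theorem exists_threshold {N : ℕ} {E : Fin N → Bool} (hE : Monotone E) :
    ∃ k : ℕ, k ≤ N ∧ ∀ i : Fin N, E i = true ↔ k ≤ i := by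
  classical
  by_cases h : ∃ k : ℕ, ∃ hk : k < N, E ⟨k, hk⟩ = true
  · obtain ⟨hk, hk'⟩ := Nat.find_spec h
    refine ⟨Nat.find h, hk.le, fun i => ⟨fun hi => Nat.find_min' h ⟨i.2, hi⟩, fun hi => ?_⟩⟩
    have := hE (show (⟨Nat.find h, hk⟩ : Fin N) ≤ i from hi)
    rw [hk'] at this
    exact top_le_iff.1 this
  · refine ⟨N, le_rfl, fun i => ⟨fun hi => absurd ⟨i, i.2, hi⟩ h, fun hi => ?_⟩⟩
    exact absurd i.2 (not_lt.2 hi)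

/-- If the displacement of `f` is small compared with the height of a tower and is constant on the
levels close to its base, then `f` is a product of a power of `T` and transformations `δ_U`. -/
theorem IsTower.mem_of_displacement [T2Space X] {T : X ≃ₜ X} {H : Subgroup (X ≃ₜ X)} (hT : T ∈ H)
    (hH : ∀ U : Set X, IsClopen U → Disjoint U (T '' U) → DeltaMem T H U) {M : Set X} {n : ℕ}
    (hM : IsTower T M (n + 1)) (hfree : ∀ (x : X) (s : ℤ), (T ^ s) x = x → s = 0) (f : X ≃ₜ X)
    {ν : X → ℤ} (hf : ∀ x, f x = (T ^ ν x) x) {K : ℕ} (hK : ∀ x, |ν x| ≤ K) (hKn : 2 * K ≤ n + 1)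
    (hν : ∀ m ∈ M, ∀ m' ∈ M, ∀ j : ℤ, |j| ≤ K → ν ((T ^ j) m) = ν ((T ^ j) m')) : f ∈ H := by
  rcases isEmpty_or_nonempty X with hX | ⟨⟨x₀⟩⟩
  · have : f = 1 := by
      ext x
      exact (IsEmpty.false x).elim
    rw [this]
    exact H.one_mem
  obtain ⟨m₀, hm₀, -⟩ := hM.exists_mem x₀
  -- With time counted from `M`, level `i` over `T ^ (-K) (M)` is time `i - K`, and `E i` says that
  -- `f` sends it to nonnegative time. This does not depend on the column: by `hν` up to time `K`,
  -- and automatically beyond.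
  let E (i : Fin (n + 1)) : Bool := decide (0 ≤ ((i : ℤ) - K) + ν ((T ^ ((i : ℤ) - K)) m₀))
  have hE : ∀ m ∈ M, ∀ i : Fin (n + 1),
      E i = true ↔ 0 ≤ ((i : ℤ) - K) + ν ((T ^ ((i : ℤ) - K)) m) := by
    intro m hm i
    simp only [E, decide_eq_true_iff]
    by_cases hi : (i : ℤ) - K ≤ K
    · rw [hν m₀ hm₀ m hm _ (by rw [abs_le]; omega)]
    · have h1 := abs_le.1 (hK ((T ^ ((i : ℤ) - K)) m))
      have h2 := abs_le.1 (hK ((T ^ ((i : ℤ) - K)) m₀))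
      omega
  -- As `false < true`, sorting lists first the levels sent to negative time, and `c` is their
  -- number.
  obtain ⟨c, hcn, hc⟩ := exists_threshold (Tuple.monotone_sort E)
  set σ := Tuple.sort E
  obtain ⟨p, hpH, hp, -⟩ := (hM.preimage K).exists_perm hH (hM.preimage K).isClopen subset_rfl σ
  -- The power of `T` brings time 0 to level `c`, and `p` then moves level `i` to a level that `f`
  -- sends to nonnegative time exactly when `c ≤ i`. In the other blocks (`q ≠ 0`) the time is too
  -- far from 0 for `f` to change its sign.
  have hgT : ∀ m ∈ M, ∀ j : ℤ, ∃ j' : ℤ,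
      (f * p * T ^ ((c : ℤ) - K)) ((T ^ j) m) = (T ^ j') m ∧ (0 ≤ j ↔ 0 ≤ j') := by
    intro m hm j
    have hpos : (0 : ℤ) < n + 1 := by positivity
    obtain ⟨q, i, hqi⟩ : ∃ (q : ℤ) (i : Fin (n + 1)), j + c = (n + 1) * q + i := by
      have h0 := Int.emod_nonneg (j + c) hpos.ne'
      have h1 := Int.emod_lt_of_pos (j + c) hpos
      refine ⟨(j + c) / (n + 1), ⟨((j + c) % (n + 1)).toNat, by omega⟩, ?_⟩
      rw [Int.toNat_of_nonneg h0]
      exact (Int.mul_ediv_add_emod _ _).symm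
    have hm' : (T ^ ((n + 1) * q - K : ℤ)) m ∈ (T ^ (K : ℤ)) ⁻¹' M := by
      rw [Set.mem_preimage, zpow_apply_zpow, hM.zpow_mem_iff m hm]
      exact ⟨q, by push_cast; ring⟩
    set s : ℤ := σ i + ((n + 1) * q - K) with hs
    have e1 : (T ^ ((c : ℤ) - K)) ((T ^ j) m) = (T ^ (i : ℤ)) ((T ^ ((n + 1) * q - K : ℤ)) m) := by
      rw [zpow_apply_zpow, zpow_apply_zpow]
      congr 2
      linarith
    have e2 : (f * p * T ^ ((c : ℤ) - K)) ((T ^ j) m) = (T ^ (s + ν ((T ^ s) m))) m := by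
      rw [Homeomorph.mul_apply, Homeomorph.mul_apply, e1, hp _ hm', zpow_apply_zpow, hf,
        zpow_apply_zpow, add_comm]
    refine ⟨_, e2, ?_⟩
    have hb := abs_le.1 (hK ((T ^ s) m))
    have hi := i.2
    have hσ := (σ i).2
    rcases lt_trichotomy q 0 with hq | rfl | hq
    · have : ((n : ℤ) + 1) * q ≤ -(n + 1) := by nlinarith
      omega
    · have e3 : s = (σ i : ℤ) - K := by rw [hs]; ring
      have h4 := hE m hm (σ i)
      have h5 := hc i
      rw [Function.comp_apply] at h5
      rw [e3, ← h4, h5]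
      rw [mul_zero] at hqi
      omega
    · have : (n : ℤ) + 1 ≤ (n + 1) * q := by nlinarith
      omega
  have hg : f * p * T ^ ((c : ℤ) - K) ∈ H := by
    -- Sign preservation at the base point `m` and at the next one, `T ^ (n + 1) m`, confines the
    -- image to the same column; freeness identifies the two time counts.
    refine hM.mem_of_preserves hH _ fun m hm i => ?_
    obtain ⟨j, hj, hj'⟩ := hgT m hm i
    have hm2 : (T ^ ((n + 1 : ℕ) : ℤ)) m ∈ M := (hM.zpow_mem_iff m hm _).2 dvd_rfl
    obtain ⟨k, hk, hk'⟩ := hgT _ hm2 (i - (n + 1 : ℕ))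
    rw [zpow_apply_zpow, sub_add_cancel, hj, zpow_apply_zpow] at hk
    have h1 := hfree m (-(k + (n + 1 : ℕ)) + j) (by rw [← zpow_apply_zpow, hk, zpow_neg_apply_zpow])
    have hi := i.2
    refine ⟨⟨j.toNat, by omega⟩, ?_⟩
    rw [hj]
    congr 2
    simp only
    omega
  rw [mul_assoc] at hg
  exact (H.mul_mem_cancel_right (H.mul_mem hpH (H.zpow_mem hT _))).1 hg

theorem self_mem_topologicalFullGroup (T : X ≃ₜ X) : T ∈ topologicalFullGroup T :=
  ⟨fun _ => 1, continuous_const, fun x => by rw [zpow_one]⟩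

theorem delta_mem_topologicalFullGroup {T : X ≃ₜ X} {U : Set X} (hU : IsClopen U)
    (hd : Disjoint U (T '' U)) : delta T U hU hd ∈ topologicalFullGroup T := by
  classical
  have hU' : IsClopen (T.symm ⁻¹' U) := hU.preimage T.symm.continuous
  refine ⟨fun x => if x ∈ U then 1 else if x ∈ T.symm ⁻¹' U then -1 else 0, ?_, fun x => ?_⟩
  · refine continuous_if (p := fun x => x ∈ U) (fun x hx => ?_) continuousOn_const
      (Continuous.continuousOn (continuous_if (p := fun x => x ∈ T.symm ⁻¹' U) (fun x hx => ?_)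
        continuousOn_const continuousOn_const))
    · have : frontier {x | x ∈ U} = ∅ := hU.frontier_eq
      rw [this] at hx
      exact hx.elim
    · have : frontier {x | x ∈ T.symm ⁻¹' U} = ∅ := hU'.frontier_eq
      rw [this] at hx
      exact hx.elim
  · rw [delta_apply]
    simp only [Set.mem_preimage]
    split_ifs
    · rw [zpow_one]
    · rw [zpow_neg_one_apply]
    · rw [zpow_zero]
      rfl

end Towers

/-! ### Conclusion for the Lysenok subshift -/

namespace Lysenok

open Letter

theorem isTower_base (n : ℕ) : IsTower T (base n) (2 ^ n) where
  isClopen := isClopen_base n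
  exists_mem ω := by
    obtain ⟨t, ht⟩ := exists_zpow_mem_base n ω
    have hpos : (0 : ℤ) < 2 ^ n := by positivity
    have h0 := Int.emod_nonneg (-t) hpos.ne'
    have h1 := Int.emod_lt_of_pos (-t) hpos
    have h2 := Int.mul_ediv_add_emod (-t) (2 ^ n)
    refine ⟨(T ^ (-((-t) % 2 ^ n))) ω, ?_, ⟨((-t) % 2 ^ n).toNat, ?_⟩, ?_⟩
    · rw [show -((-t) % 2 ^ n) = 2 ^ n * ((-t) / 2 ^ n) + t by linarith, ← zpow_apply_zpow]
      exact zpow_mem_base ht ⟨_, rfl⟩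
    · zify
      rwa [Int.toNat_of_nonneg h0]
    · rw [zpow_apply_zpow]
      simp only [Int.toNat_of_nonneg h0]
      simp
  zpow_mem_iff ω hω s := by
    push_cast
    exact ⟨dvd_of_zpow_mem_base hω, zpow_mem_base hω⟩

theorem topologicalFullGroup_le {H : Subgroup (Omega ≃ₜ Omega)} (hT : T ∈ H)
    (hH : ∀ U : Set Omega, IsClopen U → Disjoint U (T '' U) → DeltaMem T H U) :
    topologicalFullGroup T ≤ H := by
  rintro f ⟨ν, hν, hf⟩
  obtain ⟨K, hK⟩ : ∃ K : ℕ, ∀ ω, |ν ω| ≤ K := by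
    obtain ⟨C, hC⟩ := (isCompact_range (continuous_abs.comp hν)).bddAbove
    exact ⟨C.toNat, fun ω => (hC ⟨ω, rfl⟩).trans (Int.self_le_toNat C)⟩
  obtain ⟨R, hR⟩ := exists_window hν
  obtain ⟨m, hm⟩ : ∃ m : ℕ, K + R < 2 ^ m := ⟨K + R, Nat.lt_two_pow_self⟩
  -- The shift by half the height keeps the undetermined coordinates at distance at least `2 ^ m`
  -- from the origin, out of reach of the window of radius `K + R` that decides `ν` near the base.
  have htow := (isTower_base (m + 1)).preimage (2 ^ m)
  have hpos : 2 ^ (m + 1) = 2 ^ (m + 1) - 1 + 1 := (Nat.sub_add_cancel Nat.one_le_two_pow).symm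
  have hpow : 2 ^ (m + 1) = 2 * 2 ^ m := pow_succ' 2 m
  rw [hpos] at htow
  refine htow.mem_of_displacement hT hH (fun _ _ => eq_zero_of_zpow_apply_eq) f hf hK (by omega)
    fun ω hω ω' hω' j hj => hR _ _ fun i hi => ?_
  have e : ∀ ω : Omega, ((T ^ j) ω).1 i = ((T ^ (2 ^ m : ℤ)) ω).1 (i + j - 2 ^ m) := by
    intro ω
    rw [T_zpow_apply, T_zpow_apply, sub_add_cancel]
  rw [e, e]
  refine apply_eq_of_mem_base hω hω' fun hdvd => ?_
  have h1 := abs_le.1 hi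
  have h2 := abs_le.1 hj
  have h3 : (K + R : ℤ) < 2 ^ m := by exact_mod_cast hm
  have h4 : (2 : ℤ) ^ (m + 1) = 2 * 2 ^ m := pow_succ' 2 m
  have h5 := eq_zero_of_two_pow_dvd hdvd (by rw [h4, abs_lt]; constructor <;> linarith)
  linarith

end Lysenok

open Lysenok Lysenok.Letter in
theorem theorem1p8 :
    Subgroup.closure
        {T,
          deltaCylinder [] [b] (by simp),
          deltaCylinder [] [d] (by simp),
          deltaCylinder [] [a, c, a, c, a, c] (by simp)} =
      topologicalFullGroup T ∧
    Group.FG (topologicalFullGroup T) := by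
  have key : Subgroup.closure
        {T,
          deltaCylinder [] [b] (by simp),
          deltaCylinder [] [d] (by simp),
          deltaCylinder [] [a, c, a, c, a, c] (by simp)} =
      topologicalFullGroup T := by
    apply le_antisymm
    · rw [Subgroup.closure_le]
      rintro f (rfl | rfl | rfl | rfl)
      · exact self_mem_topologicalFullGroup T
      · exact delta_mem_topologicalFullGroup _ _
      · exact delta_mem_topologicalFullGroup _ _
      · exact delta_mem_topologicalFullGroup _ _
    · have hT := Subgroup.subset_closure (k := {T, deltaCylinder [] [b] (by simp),
        deltaCylinder [] [d] (by simp), deltaCylinder [] [a, c, a, c, a, c] (by simp)})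
        (Set.mem_insert _ _)
      refine topologicalFullGroup_le hT fun U hU hd => deltaMem_of_isClopen hT
        (deltaMem_pointed hT (deltaMem_of_deltaCylinder (h := by simp) (Subgroup.subset_closure ?_))
          (deltaMem_of_deltaCylinder (h := by simp) (Subgroup.subset_closure ?_))
          (deltaMem_of_deltaCylinder (h := by simp) (Subgroup.subset_closure ?_))) hU hd
      · exact Or.inr (Or.inl rfl)
      · exact Or.inr (Or.inr (Or.inl rfl))
      · exact Or.inr (Or.inr (Or.inr rfl))
  refine ⟨key, (Group.fg_iff_subgroup_fg _).2 ?_⟩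
  rw [← key]
  exact (Subgroup.fg_iff _).2 ⟨_, rfl, Set.toFinite _⟩
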